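/- **Conventions.** Work on the Riemann sphere $\overline{\mathbb C}$ with the spherical metric $d^\#$ (length element $|dz|/(1+|z|^2)$). For a sequence of polynomials $\{P_m\}_{m\ge 1}$ put $Q_{m,n}=P_n\circ\dots\circ P_{m+1}$, $0\le m\le n$. The sequence is *bounded* if the degrees $d_m$ satisfy $2\le d_m\le d$, the leading coefficients satisfy $1/K\le|a|<K$, and all other coefficients are at most $M$ in absolute value, for some constants $d,K,M$. The *iterated Julia set* $\mathcal J_m$ is the complement of the set of points having a neighbourhood on which $\{Q_{m,n}\}_{n\ge m}$ is a normal family. All critical points *escape* if, for every $m\ge0$ and every $c\in\mathbb C$ with $P_{m+1}'(c)=0$, $|Q_{m,n}(c)|\to\infty$ as $n\to\infty$. A *pointed disc* $(U,u)$ is a hyperbolic simply connected domain $U\subset\overline{\mathbb C}$ with a point $u\in U$; $\delta^\#_U(u)$ is the spherical distance from $u$ to $\partial U$. A sequence $\{f_{m+1}:U_m\to V_{m+1}\}_{m\ge0}$, with pointed discs $(U_m,u_m)$, $(V_m,u_m)$, is *polynomial-like* if for some $K\ge1$ and $d$ the following hold for all $m\ge 0$: - $|\log(\delta^\#_{U_m}(u_m)\,\mathrm{diam}^\#(\overline{\mathbb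 C}\setminus U_m))|\le K$, and the same holds for $V_m$; - $U_m\subset V_m$ lies within hyperbolic distance $K$ of $u_m$ in $V_m$, and $\delta^\#_{U_m}(u_m)\ge\frac1K\delta^\#_{V_m}(u_m)$; - $f_{m+1}$ is a proper holomorphic map of $U_m$ onto $V_{m+1}$ of degree between $2$ and $d$, and $u_m$ is a critical point of it; - the critical values of $f_{m+1}$ lie within hyperbolic distance $K$ of $u_{m+1}$ in $V_{m+1}$. Its filled Julia set $\mathcal K_m$ at time $m$ is the set of $z\in U_m$ with $f_n\circ\dots\circ f_{m+1}(z)\notin V_n\setminus U_n$ for all $n>m$. A *quasiconformal conjugacy* to another such sequence $\{\tilde f_{m+1}:\tilde U_m\to\tilde V_{m+1}\}$ is a sequence of orientation-preserving homeomorphisms $\Phi_m:U_m\to\tilde U_m$, all $K$-quasiconformal for one $K>1$, with $\Phi_m(u_m)=\tilde u_m$ and $\Phi_{m+1}\circ f_{m+1}=\tilde f_{m+1}\circ\Phi_m$ at the points of $U_m$ which $f_{m+1}$ sends into $U_{m+1}$ (that is, where the left side is defined). The family $\{\Phi_m\}$ is *bi-equicontinuous* if each $\Phi_m$ is injective, both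 $\{\Phi_m\}$ and $\{\Phi_m^{-1}\}$ are equicontinuous with respect to $d^\#$, uniformly in $m$, on $\{U_m\}$ and $\{\Phi_m(U_m)\}$ respectively (for every $\varepsilon>0$ there is a $\delta>0$ valid for all $m$ and all pairs of points of the $m$-th domain), and the pointed domains $(\Phi_m(U_m),\Phi_m(u_m))$ form a non-degenerate family (all Carathéodory limits of its sequences are pointed hyperbolic domains). A *hybrid equivalence* is a bi-equicontinuous quasiconformal conjugacy for which the dilatation of each $\Phi_m$ vanishes a.e. on $\mathcal K_m$. A *polynomial-like restriction* of $\{P_m\}$ is a polynomial-like sequence with $f_{m+1}=P_{m+1}|_{U_m}$ of degree $\deg P_{m+1}$. Two sequences of polynomials are *hybrid equivalent* if some polynomial-like restrictions of them are. **Theorem 7.2.** For $m\ge1$ let $$P_m(z)=\begin{cases}(z-3)^2,& m=\frac{(j+1)(j+2)}2-1\text{ for some integer }j\ge1,\\ z^2,&\text{otherwise.}\end{cases}$$ Then $\{P_m\}_{m\ge 1}$ is a bounded sequence of quadratic polynomials, all its critical points escape, and every iterated Julia set $\mathcal J_m$, $m\ge0$, is totally disconnected. For every quadratic polynomial $Q$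 with disconnected Julia set, $\{P_m\}$ is not hybrid equivalent to the constant sequence $Q,Q,Q,\dots$; moreover, no quasiconformal conjugacy from a polynomial-like restriction of $\{P_m\}$ to a polynomial-like restriction of that constant sequence is bi-equicontinuous. -/

import Mathlib

open Filter Topology MeasureTheory Polynomial
open scoped ContDiff

noncomputable section

namespace NonautDyn

/-! ### The Riemann sphere -/

/-- The Riemann sphere, with the topology of the one-point compactification. -/
abbrev Sph : Type := OnePoint ℂ

/-- Chordal distance on the unit-diameter sphere. -/
def chordal : Sph → Sph → ℝ
  | OnePoint.infty, OnePoint.infty => 0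
  | OnePoint.infty, OnePoint.some w => 1 / √(1 + ‖w‖ ^ 2)
  | OnePoint.some z, OnePoint.infty => 1 / √(1 + ‖z‖ ^ 2)
  | OnePoint.some z, OnePoint.some w => ‖z - w‖ / (√(1 + ‖z‖ ^ 2) * √(1 + ‖w‖ ^ 2))

/-- Spherical (geodesic) distance for the length element `|dz| / (1 + |z|^2)`, for which the
sphere has diameter `π / 2`. -/
def sphDist (z w : Sph) : ℝ := Real.arcsin (chordal z w)

/-- The inversion `z ↦ 1 / z` of the sphere. -/
def sphInv : Sph → Sph
  | OnePoint.infty => ((0 : ℂ) : Sph)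
  | OnePoint.some z => if z = 0 then OnePoint.infty else ((z⁻¹ : ℂ) : Sph)

/-- The finite coordinate of a point (the value at infinity is irrelevant). -/
def toPlane : Sph → ℂ
  | OnePoint.infty => 0
  | OnePoint.some z => z

/-- The two standard charts of the sphere: `false` is the coordinate `z`, `true` is the
coordinate `1 / z`. The chart `b` is defined off the point `pole b`. -/
def pole : Bool → Sph
  | false => OnePoint.infty
  | true => ((0 : ℂ) : Sph)

/-- The coordinate function of the chart `b` (meaningful off `pole b`). -/
def coord : Bool → Sph → ℂ
  | false, w => toPlane w
  | true, w => toPlane (sphInv w)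

/-- The inverse of the chart `b`, a bijection from `ℂ` onto the complement of `pole b`. -/
def param : Bool → ℂ → Sph
  | false, z => (z : Sph)
  | true, z => sphInv (z : Sph)

/-- The expression of `f` in the chart `b` of the source and the chart `c` of the target. -/
def localRep (b c : Bool) (f : Sph → Sph) (z : ℂ) : ℂ := coord c (f (param b z))

/-- The set on which `localRep b c f` represents the restriction of `f` to `U`. -/
def localDomain (b c : Bool) (f : Sph → Sph) (U : Set Sph) : Set ℂ :=
  {z | param b z ∈ U ∧ f (param b z) ≠ pole c}

/-- `f` is analytic on the open subset `U` of the sphere, as a map to the sphere. -/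
def SphHolomorphicOn (f : Sph → Sph) (U : Set Sph) : Prop :=
  ContinuousOn f U ∧
    ∀ b c, DifferentiableOn ℂ (localRep b c f) (localDomain b c f U)

/-- The point `u` of `U` is a critical point of `f`: the derivative vanishes there (in charts). -/
def IsCriticalPt (f : Sph → Sph) (U : Set Sph) (u : Sph) : Prop :=
  u ∈ U ∧ ∀ b c z, z ∈ localDomain b c f U → param b z = u → deriv (localRep b c f) z = 0

/-! ### Pointed discs, hyperbolic distance, the Carathéodory bound -/

/-- `φ` restricted to the unit disc is a conformal bijection onto `V`. -/
structure IsRiemannMap (φ : ℂ → Sph) (V : Set Sph) : Prop where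
  continuousOn : ContinuousOn φ (Metric.ball 0 1)
  holomorphic : ∀ c, DifferentiableOn ℂ (fun z => coord c (φ z))
    {z | z ∈ Metric.ball (0 : ℂ) 1 ∧ φ z ≠ pole c}
  injOn : Set.InjOn φ (Metric.ball 0 1)
  image_eq : φ '' Metric.ball 0 1 = V

/-- `(U, u)` is a pointed disc: `U` is a hyperbolic simply connected domain of the sphere,
that is, a conformal image of the unit disc, and `u` is a point of `U`. -/
def IsPointedDisc (U : Set Sph) (u : Sph) : Prop :=
  u ∈ U ∧ ∃ φ, IsRiemannMap φ U

/-- The hyperbolic distance (curvature `-1`) from `x` to `y` in the disc `V` is at most `R`: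
in the unit disc the point `z` has hyperbolic distance `2 artanh |z|` from `0`. -/
def HypDistLE (V : Set Sph) (x y : Sph) (R : ℝ) : Prop :=
  ∃ φ, IsRiemannMap φ V ∧ φ 0 = x ∧
    ∃ z ∈ Metric.ball (0 : ℂ) 1, φ z = y ∧ ‖z‖ ≤ Real.tanh (R / 2)

/-- Spherical distance of `u` to the boundary of `U`. -/
def boundaryDist (U : Set Sph) (u : Sph) : ℝ := sInf (sphDist u '' frontier U)

/-- Spherical diameter. -/
def sphDiam (E : Set Sph) : ℝ := sSup (Set.image2 sphDist E E)

/-- The Carathéodory bound of a sequence of pointed discs is at most `K`. -/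
def CaratheodoryBoundLE (U : ℕ → Set Sph) (u : ℕ → Sph) (K : ℝ) : Prop :=
  ∀ m, |Real.log (boundaryDist (U m) (u m) * sphDiam (U m)ᶜ)| ≤ K

/-- The sequence of pointed discs `(U, u)` is bounded above and below in the sequence of pointed
discs `(V, v)`, with constant `K`. -/
def BoundedIn (U : ℕ → Set Sph) (u : ℕ → Sph) (V : ℕ → Set Sph) (v : ℕ → Sph) (K : ℝ) : Prop :=
  ∀ m, U m ⊆ V m ∧ (∀ x ∈ U m, HypDistLE (V m) (v m) x K) ∧
    1 / K * boundaryDist (V m) (u m) ≤ boundaryDist (U m) (u m)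

/-- Convergence of pointed domains to a pointed domain in the Carathéodory topology. -/
def CaratheodoryTendsto (U : ℕ → Set Sph) (u : ℕ → Sph) (W : Set Sph) (w : Sph) : Prop :=
  Tendsto u atTop (𝓝 w) ∧
  (∀ C, IsCompact C → C ⊆ W → ∀ᶠ i in atTop, C ⊆ U i) ∧
  (∀ N, IsOpen N → IsConnected N → w ∈ N → (∃ᶠ i in atTop, N ⊆ U i) → N ⊆ W)

/-- Convergence of pointed domains to the degenerate limit `({w}, w)`. -/
def CaratheodoryTendstoPoint (U : ℕ → Set Sph) (u : ℕ → Sph) (w : Sph) : Prop :=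
  Tendsto u atTop (𝓝 w) ∧
  (∀ N, IsOpen N → IsConnected N → w ∈ N → ¬ ∃ᶠ i in atTop, N ⊆ U i)

/-- A family of pointed domains is (hyperbolically) non-degenerate: every Carathéodory limit of a
sequence in the family is a pointed hyperbolic domain, that is, a domain which omits at least
three points of the sphere. -/
def IsNonDegenerate (U : ℕ → Set Sph) (u : ℕ → Sph) : Prop :=
  ∀ k : ℕ → ℕ,
    (∀ W w, IsOpen W → IsConnected W → w ∈ W →
      CaratheodoryTendsto (fun i => U (k i)) (fun i => u (k i)) W w → 3 ≤ Wᶜ.encard) ∧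
    (∀ w, ¬ CaratheodoryTendstoPoint (fun i => U (k i)) (fun i => u (k i)) w)

/-! ### Non-autonomous iteration

Sequences of maps are indexed so that `f (m + 1)` leads from time `m` to time `m + 1`; the value
`f 0` is never used. -/

/-- `compFrom f m k = f (m + k) ∘ ⋯ ∘ f (m + 1)`, the composition from time `m` to `m + k`. -/
def compFrom {X : Type*} (f : ℕ → X → X) (m : ℕ) : ℕ → X → X
  | 0 => id
  | k + 1 => f (m + k + 1) ∘ compFrom f m k

/-- The action of a (non-constant) polynomial on the sphere. -/
def polyMap (p : ℂ[X]) : Sph → Sph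
  | OnePoint.infty => OnePoint.infty
  | OnePoint.some z => ((p.eval z : ℂ) : Sph)

/-- Bounded sequences of polynomials `P 1, P 2, …`. -/
def IsBoundedSeq (P : ℕ → ℂ[X]) : Prop :=
  ∃ (d : ℕ) (M K : ℝ), 2 ≤ d ∧ 0 ≤ M ∧ 1 ≤ K ∧ ∀ m, 1 ≤ m →
    2 ≤ (P m).natDegree ∧ (P m).natDegree ≤ d ∧
    1 / K ≤ ‖(P m).leadingCoeff‖ ∧ ‖(P m).leadingCoeff‖ < K ∧
    ∀ k < (P m).natDegree, ‖(P m).coeff k‖ ≤ M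

/-- Normality on an open set `N`: every sequence in the family has a subsequence which converges
uniformly on compact subsets of `N` in the spherical metric. -/
def IsNormalOn (F : ℕ → Sph → Sph) (N : Set Sph) : Prop :=
  ∀ k : ℕ → ℕ, ∃ s : ℕ → ℕ, StrictMono s ∧ ∃ g : Sph → Sph,
    ∀ C, IsCompact C → C ⊆ N → ∀ ε > 0, ∀ᶠ i in atTop, ∀ x ∈ C,
      sphDist (F (k (s i)) x) (g x) < ε

/-- The iterated Fatou set at time `m`. -/
def fatou (P : ℕ → ℂ[X]) (m : ℕ) : Set Sph :=
  {z | ∃ N, IsOpen N ∧ z ∈ N ∧ IsNormalOn (compFrom (fun i => polyMap (P i)) m) N}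

/-- The iterated Julia set at time `m`. -/
def julia (P : ℕ → ℂ[X]) (m : ℕ) : Set Sph := (fatou P m)ᶜ

/-- All critical points escape: for every time `m`, each critical point of `P (m + 1)` lies in the
basin of infinity at time `m`. -/
def AllCriticalPointsEscape (P : ℕ → ℂ[X]) : Prop :=
  ∀ (m : ℕ) (c : ℂ), (derivative (P (m + 1))).eval c = 0 →
    Tendsto (fun k => ‖compFrom (fun i z => (P i).eval z) m k c‖) atTop atTop

/-! ### Polynomial-like sequences -/

/-- `f` restricts to a proper analytic map of degree `e` of `U` onto `V`; the degree of such a map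
is the largest (equivalently, the generic) number of points in a fibre. -/
structure IsProperOfDegree (f : Sph → Sph) (U V : Set Sph) (e : ℕ) : Prop where
  holomorphic : SphHolomorphicOn f U
  image_eq : f '' U = V
  proper : ∀ C, IsCompact C → C ⊆ V → IsCompact (U ∩ f ⁻¹' C)
  fibre_le : ∀ w ∈ V, (U ∩ f ⁻¹' {w}).Finite ∧ (U ∩ f ⁻¹' {w}).ncard ≤ e
  fibre_eq : ∃ w ∈ V, (U ∩ f ⁻¹' {w}).ncard = e

/-- `f (m + 1) : U m → V (m + 1)` is a polynomial-like sequence of degree bound `d`, with base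
points `u m` of `U m` and `V m`. -/
def IsPolynomialLike (U V : ℕ → Set Sph) (u : ℕ → Sph) (f : ℕ → Sph → Sph) (d : ℕ) : Prop :=
  (∀ m, IsPointedDisc (U m) (u m) ∧ IsPointedDisc (V m) (u m)) ∧
  ∃ K : ℝ, 1 ≤ K ∧
    (CaratheodoryBoundLE U u K ∧ CaratheodoryBoundLE V u K ∧ BoundedIn U u V u K) ∧
    (∀ m, (∃ e, 2 ≤ e ∧ e ≤ d ∧ IsProperOfDegree (f (m + 1)) (U m) (V (m + 1)) e) ∧
      IsCriticalPt (f (m + 1)) (U m) (u m)) ∧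
    (∀ m z, IsCriticalPt (f (m + 1)) (U m) z →
      HypDistLE (V (m + 1)) (u (m + 1)) (f (m + 1) z) K)

/-- The iterated filled Julia set at time `m` of a polynomial-like sequence. -/
def filledJulia (U V : ℕ → Set Sph) (f : ℕ → Sph → Sph) (m : ℕ) : Set Sph :=
  {z | z ∈ U m ∧ ∀ k, 1 ≤ k → compFrom f m k z ∉ V (m + k) \ U (m + k)}

/-- The domains `U`, `V` with base points `u` exhibit the sequence of polynomials `P` as a
polynomial-like sequence with the same degrees. -/
def IsPolynomialLikeRestriction (P : ℕ → ℂ[X]) (U V : ℕ → Set Sph) (u : ℕ → Sph) : Prop :=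
  (∃ d, IsPolynomialLike U V u (fun m => polyMap (P m)) d) ∧
  ∀ m, IsProperOfDegree (polyMap (P (m + 1))) (U m) (V (m + 1)) (P (m + 1)).natDegree

/-! ### Quasiconformal maps -/

/-- `gx` and `gy` are the weak partial derivatives of `g` on the open set `Ω`, and they are locally
square-integrable on `Ω`. -/
structure HasWeakGrad (Ω : Set ℂ) (g gx gy : ℂ → ℂ) : Prop where
  memLp : ∀ C, IsCompact C → C ⊆ Ω →
    MemLp gx 2 (volume.restrict C) ∧ MemLp gy 2 (volume.restrict C)
  weak_deriv : ∀ η : ℂ → ℝ, ContDiff ℝ ∞ η → HasCompactSupport η → tsupport η ⊆ Ω →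
    (∫ z, fderiv ℝ η z 1 • g z) = -∫ z, η z • gx z ∧
    (∫ z, fderiv ℝ η z Complex.I • g z) = -∫ z, η z • gy z

/-- The analytic definition of `K`-quasiconformality, in charts, for a homeomorphism `Φ` of the
open set `U` onto its image: `Φ` is locally of class `W^{1,2}` and
`|∂̄Φ| ≤ (K - 1) / (K + 1) |∂Φ|` almost everywhere. With `∂ = (∂_x - i ∂_y) / 2` and
`∂̄ = (∂_x + i ∂_y) / 2`; this inequality makes the Jacobian nonnegative, so it
includes that `Φ` preserves orientation. -/
def IsQuasiconformalOn (K : ℝ) (Φ : Sph → Sph) (U : Set Sph) : Prop :=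
  ∀ b c, ∃ gx gy, HasWeakGrad (localDomain b c Φ U) (localRep b c Φ) gx gy ∧
    ∀ᵐ z, z ∈ localDomain b c Φ U →
      ‖gx z + Complex.I * gy z‖ ≤ (K - 1) / (K + 1) * ‖gx z - Complex.I * gy z‖

/-- The dilatation of `Φ`, a quasiconformal map of `U`, vanishes almost everywhere on `E ⊆ U`:
`∂̄Φ = 0` almost everywhere there, in charts. -/
def DilatationZeroOn (Φ : Sph → Sph) (U E : Set Sph) : Prop :=
  ∀ b c, ∃ gx gy, HasWeakGrad (localDomain b c Φ U) (localRep b c Φ) gx gy ∧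
    ∀ᵐ z, z ∈ localDomain b c Φ U → param b z ∈ E → gx z + Complex.I * gy z = 0

/-! ### Hybrid equivalence -/

/-- Equicontinuity of a family of maps `Φ m` on varying sets `U m`. -/
def IsEquicontinuousOnFamily (Φ : ℕ → Sph → Sph) (U : ℕ → Set Sph) : Prop :=
  ∀ ε > 0, ∃ δ > 0, ∀ m, ∀ x ∈ U m, ∀ y ∈ U m,
    sphDist x y < δ → sphDist (Φ m x) (Φ m y) < ε

/-- Bi-equicontinuity: the family `Φ` is equicontinuous, its members are injective, the image
family is non-degenerate, and the family of inverse maps is equicontinuous on the image family. -/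
def IsBiEquicontinuous (Φ : ℕ → Sph → Sph) (U : ℕ → Set Sph) (u : ℕ → Sph) : Prop :=
  IsEquicontinuousOnFamily Φ U ∧
  (∀ m, Set.InjOn (Φ m) (U m)) ∧
  IsNonDegenerate (fun m => Φ m '' U m) (fun m => Φ m (u m)) ∧
  IsEquicontinuousOnFamily (fun m => Function.invFunOn (Φ m) (U m)) (fun m => Φ m '' U m)

/-- `Φ m : U m → U' m` are orientation-preserving, `K`-quasiconformal homeomorphisms for one and
the same `K`, which respect the base points and conjugate `f` to `f'`. The functional equation
`Φ (m + 1) ∘ f (m + 1) = f' (m + 1) ∘ Φ m` is required where its left side is defined, that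
is, at the points of `U m` which `f (m + 1)` sends into `U (m + 1)`. -/
structure IsQCConjugacy (U : ℕ → Set Sph) (u : ℕ → Sph) (f : ℕ → Sph → Sph)
    (U' : ℕ → Set Sph) (u' : ℕ → Sph) (f' : ℕ → Sph → Sph) (Φ : ℕ → Sph → Sph) : Prop where
  bijOn : ∀ m, Set.BijOn (Φ m) (U m) (U' m)
  continuousOn : ∀ m, ContinuousOn (Φ m) (U m)
  continuousOn_inv : ∀ m, ContinuousOn (Function.invFunOn (Φ m) (U m)) (U' m)
  base : ∀ m, Φ m (u m) = u' m
  quasiconformal : ∃ K : ℝ, 1 < K ∧ ∀ m, IsQuasiconformalOn K (Φ m) (U m)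
  conj : ∀ m, ∀ z ∈ U m, f (m + 1) z ∈ U (m + 1) →
    Φ (m + 1) (f (m + 1) z) = f' (m + 1) (Φ m z)

/-- `Φ` is a hybrid equivalence between two polynomial-like sequences. -/
structure IsHybridEquivalence (U V : ℕ → Set Sph) (u : ℕ → Sph) (f : ℕ → Sph → Sph)
    (U' : ℕ → Set Sph) (u' : ℕ → Sph) (f' : ℕ → Sph → Sph) (Φ : ℕ → Sph → Sph) : Prop where
  conjugacy : IsQCConjugacy U u f U' u' f' Φ
  biEquicontinuous : IsBiEquicontinuous Φ U u
  dilatation : ∀ m, DilatationZeroOn (Φ m) (U m) (filledJulia U V f m)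

/-- Two sequences of polynomials are hybrid equivalent: they have polynomial-like restrictions
(of full degree) which are hybrid equivalent. -/
def HybridEquivalent (P Q : ℕ → ℂ[X]) : Prop :=
  ∃ U V u U' V' u', IsPolynomialLikeRestriction P U V u ∧ IsPolynomialLikeRestriction Q U' V' u' ∧
    ∃ Φ, IsHybridEquivalence U V u (fun m => polyMap (P m)) U' u' (fun m => polyMap (Q m)) Φ

end NonautDyn

end

open NonautDyn

/-! ### Distances and charts on the sphere -/

namespace NonautDyn

/-! The obstruction to a conjugacy lies in the base points. Let `c m` be the finite critical point
of `P (m + 1)`. In a polynomial-like restriction of full degree each `U m` is the whole preimage of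
`V (m + 1)`, hence invariant under the reflection in `c m`. A disc with this symmetry cannot contain
both fixed points `c m` and `∞` (`IsPointedDisc.infty_notMem_of_reflect`), and the base point is the
one it contains. As `∞` is fixed by every polynomial, a base point which is finite at one time is
finite at all later times.

For `shiftSeq` the base points cannot all be `∞`: the Carathéodory bound would give some `U m` a
neighbourhood of `∞` of definite size, which the escaping orbit of `0` has entered by then, and
pulling back would put `0`, the critical point of the first map, into `U 0`. Nor can those of a
conjugate restriction of `Q` all be `∞`, since each base point of `shiftSeq` would then be sent to
the next, whereas `0` is not sent to `3`. So at all late times both base points are the finite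
critical points. At two consecutive steps `z ^ 2` the base point `0` goes to the base point `0`; the
conjugacy carries this to `Q c = c` (`IsQCConjugacy.critical_value_eq`). Such a `Q` is affinely
conjugate to `z ^ 2`, so its Julia set is a circle, which is connected (`julia_eq`).

The critical orbits escape because `0` waits at `0` until the next shift sends it to `9`, beyond
which moduli grow by a factor `4`. The Julia sets lie in the sets of trapped points, which never
reach modulus `9`. Connected sets of trapped points are so small, compared with their distance from
the critical values, that each step expands them by more than `1.4` (`two_mul_lt_norm_add_sq`,
`smallConnectedSets`); being bounded, they are single points. -/

@[simp] lemma chordal_self (z : Sph) : chordal z z = 0 := by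
  induction z using OnePoint.rec <;> simp [chordal]

@[simp] lemma sphDist_self (z : Sph) : sphDist z z = 0 := by simp [sphDist]

lemma chordal_coe_infty (z : ℂ) : chordal (z : Sph) OnePoint.infty = 1 / √(1 + ‖z‖ ^ 2) := rfl

lemma chordal_infty_coe (z : ℂ) : chordal OnePoint.infty (z : Sph) = 1 / √(1 + ‖z‖ ^ 2) := rfl

lemma chordal_coe_coe (z w : ℂ) : chordal (z : Sph) (w : Sph) =
    ‖z - w‖ / (√(1 + ‖z‖ ^ 2) * √(1 + ‖w‖ ^ 2)) := rfl

lemma one_le_sqrt_one_add_sq (x : ℝ) : 1 ≤ √(1 + x ^ 2) :=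
  Real.one_le_sqrt.2 (by nlinarith [sq_nonneg x])

lemma chordal_nonneg (z w : Sph) : 0 ≤ chordal z w := by
  induction z using OnePoint.rec <;> induction w using OnePoint.rec <;>
    simp only [chordal_coe_coe, chordal_coe_infty, chordal_infty_coe, chordal_self] <;> positivity

lemma eq_of_chordal_eq_zero {z w : Sph} (h : chordal z w = 0) : z = w := by
  induction z using OnePoint.rec with
  | infty =>
    induction w using OnePoint.rec with
    | infty => rfl
    | coe w =>
      have : 0 < √(1 + ‖w‖ ^ 2) := by positivity
      rw [chordal_infty_coe] at h
      exact absurd h (by positivity)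
  | coe z =>
    induction w using OnePoint.rec with
    | infty =>
      have : 0 < √(1 + ‖z‖ ^ 2) := by positivity
      rw [chordal_coe_infty] at h
      exact absurd h (by positivity)
    | coe w =>
      have h1 : 0 < √(1 + ‖z‖ ^ 2) := by positivity
      have h2 : 0 < √(1 + ‖w‖ ^ 2) := by positivity
      rw [chordal_coe_coe, div_eq_zero_iff] at h
      rcases h with h | h
      · rw [norm_eq_zero, sub_eq_zero] at h
        rw [h]
      · exact absurd h (by positivity)

lemma chordal_coe_le (z w : ℂ) : chordal (z : Sph) (w : Sph) ≤ ‖z - w‖ := by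
  rw [chordal_coe_coe]
  exact div_le_self (norm_nonneg _)
    (one_le_mul_of_one_le_of_one_le (one_le_sqrt_one_add_sq _) (one_le_sqrt_one_add_sq _))

lemma chordal_coe_infty_le {z : ℂ} (hz : z ≠ 0) : chordal (z : Sph) OnePoint.infty ≤ 1 / ‖z‖ := by
  rw [chordal_coe_infty]
  exact one_div_le_one_div_of_le (norm_pos_iff.2 hz)
    (Real.le_sqrt_of_sq_le (by linarith))

lemma continuous_chordal_coe (w : Sph) : Continuous fun z : ℂ => chordal (z : Sph) w := by
  induction w using OnePoint.rec with
  | infty =>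
    simp only [chordal_coe_infty]
    exact continuous_const.div (by fun_prop) fun z => by positivity
  | coe w =>
    simp only [chordal_coe_coe]
    exact Continuous.div (by fun_prop) (by fun_prop) fun z => by positivity

lemma continuous_sphDist_coe (w : Sph) : Continuous fun z : ℂ => sphDist (z : Sph) w :=
  Real.continuous_arcsin.comp (continuous_chordal_coe w)

lemma exists_sphDist_lt {ε : ℝ} (hε : 0 < ε) :
    ∃ δ > 0, ∀ z w : Sph, chordal z w < δ → sphDist z w < ε := by
  have := Real.continuous_arcsin.tendsto 0
  rw [Real.arcsin_zero, Metric.tendsto_nhds_nhds] at this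
  obtain ⟨δ, hδ, h⟩ := this ε hε
  refine ⟨δ, hδ, fun z w hzw => ?_⟩
  have := h (x := chordal z w) (by
    rw [Real.dist_eq, sub_zero, abs_of_nonneg (chordal_nonneg z w)]; exact hzw)
  rw [Real.dist_eq, sub_zero] at this
  exact (abs_lt.1 this).2

lemma sphDist_nonneg (z w : Sph) : 0 ≤ sphDist z w := Real.arcsin_nonneg.2 (chordal_nonneg z w)

lemma sphDist_le (z w : Sph) : sphDist z w ≤ Real.pi / 2 := Real.arcsin_le_pi_div_two _

lemma bddAbove_image2_sphDist (E : Set Sph) : BddAbove (Set.image2 sphDist E E) := by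
  refine ⟨Real.pi / 2, ?_⟩
  rintro _ ⟨z, _, w, _, rfl⟩
  exact sphDist_le z w

lemma sphDiam_le (E : Set Sph) : sphDiam E ≤ Real.pi / 2 := by
  refine Real.sSup_le ?_ (by positivity)
  rintro _ ⟨z, _, w, _, rfl⟩
  exact sphDist_le z w

lemma sphDist_le_sphDiam {E : Set Sph} {z w : Sph} (hz : z ∈ E) (hw : w ∈ E) :
    sphDist z w ≤ sphDiam E :=
  le_csSup (bddAbove_image2_sphDist E) ⟨z, hz, w, hw, rfl⟩

lemma sphDist_pos {z w : Sph} (h : z ≠ w) : 0 < sphDist z w :=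
  Real.arcsin_pos.2 ((chordal_nonneg z w).lt_of_ne fun h' => h (eq_of_chordal_eq_zero h'.symm))

@[simp] lemma sphInv_infty : sphInv OnePoint.infty = ((0 : ℂ) : Sph) := rfl

lemma sphInv_coe (z : ℂ) :
    sphInv (z : Sph) = if z = 0 then OnePoint.infty else ((z⁻¹ : ℂ) : Sph) := rfl

@[simp] lemma sphInv_zero : sphInv ((0 : ℂ) : Sph) = OnePoint.infty := by simp [sphInv_coe]

lemma sphInv_sphInv (z : Sph) : sphInv (sphInv z) = z := by
  induction z using OnePoint.rec with
  | infty => simp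
  | coe z =>
    by_cases h : z = 0
    · simp [h]
    · simp [sphInv_coe, h]

lemma tendsto_coe_infty_iff {α : Type*} {l : Filter α} {f : α → ℂ} :
    Tendsto (fun x => (f x : Sph)) l (𝓝 OnePoint.infty) ↔ Tendsto (fun x => ‖f x‖) l atTop := by
  rw [tendsto_norm_atTop_iff_cobounded, Metric.cobounded_eq_cocompact,
    ← coclosedCompact_eq_cocompact, ← OnePoint.comap_coe_nhds_infty, tendsto_comap_iff]
  rfl

lemma continuous_sphInv : Continuous sphInv := by
  rw [OnePoint.continuous_iff]
  constructor
  · rw [coclosedCompact_eq_cocompact, ← Metric.cobounded_eq_cocompact, sphInv_infty]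
    have h : Tendsto (fun z : ℂ => ((z⁻¹ : ℂ) : Sph)) (Bornology.cobounded ℂ)
        (𝓝 ((0 : ℂ) : Sph)) :=
      (OnePoint.continuous_coe.tendsto _).comp tendsto_inv₀_cobounded
    refine h.congr' ?_
    filter_upwards [Bornology.eventually_ne_cobounded (0 : ℂ)] with z hz
    simp [sphInv_coe, hz]
  · rw [continuous_iff_continuousAt]
    intro z
    by_cases hz : z = 0
    · subst hz
      rw [continuousAt_iff_punctured_nhds, sphInv_zero]
      have h : Tendsto (fun z : ℂ => ((z⁻¹ : ℂ) : Sph)) (𝓝[≠] 0) (𝓝 OnePoint.infty) := by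
        rw [tendsto_coe_infty_iff]
        exact tendsto_norm_cobounded_atTop.comp tendsto_inv₀_nhdsNE_zero
      refine h.congr' ?_
      filter_upwards [self_mem_nhdsWithin] with z hz
      have : z ≠ 0 := hz
      simp [sphInv_coe, this]
    · have h : ContinuousAt (fun z : ℂ => ((z⁻¹ : ℂ) : Sph)) z :=
        (OnePoint.continuous_coe.continuousAt).comp (continuousAt_inv₀ hz)
      refine h.congr ?_
      filter_upwards [isOpen_ne.mem_nhds hz] with z hz
      have : z ≠ 0 := hz
      simp [sphInv_coe, this]

/-- The inversion as a homeomorphism of the sphere. -/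
noncomputable def sphInvHomeo : Sph ≃ₜ Sph where
  toFun := sphInv
  invFun := sphInv
  left_inv := sphInv_sphInv
  right_inv := sphInv_sphInv
  continuous_toFun := continuous_sphInv
  continuous_invFun := continuous_sphInv

lemma isOpenEmbedding_param (b : Bool) : IsOpenEmbedding (param b) := by
  cases b
  · exact OnePoint.isOpenEmbedding_coe
  · exact sphInvHomeo.isOpenEmbedding.comp OnePoint.isOpenEmbedding_coe

lemma param_coord {b : Bool} {z : Sph} (h : z ≠ pole b) : param b (coord b z) = z := by
  cases b
  · induction z using OnePoint.rec with
    | infty => exact absurd rfl h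
    | coe z => rfl
  · have h' : sphInv z ≠ OnePoint.infty := fun h' => h (by
      rw [← sphInv_sphInv z, h']; rfl)
    obtain ⟨w, hw⟩ := OnePoint.ne_infty_iff_exists.1 h'
    change sphInv ((toPlane (sphInv z) : ℂ) : Sph) = z
    rw [← hw]
    change sphInv (w : Sph) = z
    rw [hw, sphInv_sphInv]

lemma exists_ne_pole (z : Sph) : ∃ b, z ≠ pole b := by
  by_cases h : z = OnePoint.infty
  · exact ⟨true, by rw [h]; exact OnePoint.infty_ne_coe _⟩
  · exact ⟨false, h⟩

/-! ### Conformal discs -/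

/-- This is the open mapping theorem read in a chart of the target; injectivity excludes the
constant case. -/
lemma IsRiemannMap.isOpen_image {φ : ℂ → Sph} {V : Set Sph} (h : IsRiemannMap φ V) {S : Set ℂ}
    (hS : IsOpen S) (hSb : S ⊆ Metric.ball 0 1) : IsOpen (φ '' S) := by
  rw [isOpen_iff_mem_nhds]
  rintro _ ⟨z, hz, rfl⟩
  obtain ⟨c, hc⟩ := exists_ne_pole (φ z)
  have hopen : IsOpen (S ∩ φ ⁻¹' {pole c}ᶜ) :=
    (h.continuousOn.mono hSb).isOpen_inter_preimage hS isOpen_compl_singleton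
  obtain ⟨r, hr, hball⟩ := Metric.isOpen_iff.1 hopen z ⟨hz, hc⟩
  set B := Metric.ball z r
  have hd : DifferentiableOn ℂ (fun z => coord c (φ z)) B :=
    (h.holomorphic c).mono fun w hw => ⟨hSb (hball hw).1, (hball hw).2⟩
  have himg : φ '' B = param c '' ((fun z => coord c (φ z)) '' B) := by
    rw [Set.image_image]
    exact Set.image_congr fun w hw => (param_coord (hball hw).2).symm
  have hinj : Set.InjOn (fun z => coord c (φ z)) B := by
    intro x hx y hy hxy
    apply h.injOn (hSb (hball hx).1) (hSb (hball hy).1)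
    rw [← param_coord (hball hx).2, ← param_coord (hball hy).2]
    exact congrArg _ hxy
  have hB : IsOpen ((fun z => coord c (φ z)) '' B) := by
    rcases (hd.analyticOnNhd Metric.isOpen_ball).is_constant_or_isOpen
      (convex_ball z r).isPreconnected with ⟨w, hw⟩ | ho
    · exfalso
      have hmem : z + (r / 2 : ℝ) ∈ B := by
        simp only [B, Metric.mem_ball, dist_self_add_left, Complex.norm_real, Real.norm_eq_abs]
        rw [abs_of_pos (by positivity)]
        linarith
      have := hinj (Metric.mem_ball_self hr) hmem
        ((hw z (Metric.mem_ball_self hr)).trans (hw _ hmem).symm)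
      have h0 : ((r / 2 : ℝ) : ℂ) = 0 := by simpa using this
      rw [Complex.ofReal_eq_zero] at h0
      linarith
    · exact ho _ subset_rfl Metric.isOpen_ball
  have : IsOpen (φ '' B) := by
    rw [himg]
    exact (isOpenEmbedding_param c).isOpenMap _ hB
  exact mem_of_superset (this.mem_nhds ⟨z, Metric.mem_ball_self hr, rfl⟩)
    (Set.image_mono fun w hw => (hball hw).1)

lemma IsRiemannMap.isOpen {φ : ℂ → Sph} {V : Set Sph} (h : IsRiemannMap φ V) : IsOpen V := by
  rw [← h.image_eq]
  exact h.isOpen_image Metric.isOpen_ball subset_rfl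

lemma IsRiemannMap.isPreconnected {φ : ℂ → Sph} {V : Set Sph} (h : IsRiemannMap φ V) :
    IsPreconnected V := by
  rw [← h.image_eq]
  exact (convex_ball 0 1).isPreconnected.image _ h.continuousOn

lemma IsRiemannMap.exists_continuousOn_inv {φ : ℂ → Sph} {V : Set Sph} (h : IsRiemannMap φ V) :
    ∃ ψ : Sph → ℂ, ContinuousOn ψ V ∧ Set.MapsTo ψ V (Metric.ball 0 1) ∧
      ∀ w ∈ V, φ (ψ w) = w := by
  have hsurj : Set.SurjOn φ (Metric.ball 0 1) V := h.image_eq.ge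
  have hmaps := hsurj.mapsTo_invFunOn
  have hright : ∀ w ∈ V, φ (Function.invFunOn φ (Metric.ball 0 1) w) = w :=
    fun w hw => hsurj.rightInvOn_invFunOn hw
  refine ⟨Function.invFunOn φ (Metric.ball 0 1), ?_, hmaps, hright⟩
  rw [continuousOn_iff']
  intro t ht
  refine ⟨φ '' (t ∩ Metric.ball 0 1),
    h.isOpen_image (ht.inter Metric.isOpen_ball) Set.inter_subset_right, ?_⟩
  ext w
  constructor
  · rintro ⟨hwt, hw⟩
    exact ⟨⟨_, ⟨hwt, hmaps hw⟩, hright w hw⟩, hw⟩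
  · rintro ⟨⟨x, ⟨hxt, hxb⟩, rfl⟩, hw⟩
    refine ⟨?_, hw⟩
    have : Function.invFunOn φ (Metric.ball 0 1) (φ x) = x :=
      h.injOn (hmaps hw) hxb (hright _ hw)
    rwa [Set.mem_preimage, this]

lemma IsRiemannMap.ne_univ {φ : ℂ → Sph} {V : Set Sph} (h : IsRiemannMap φ V) :
    V ≠ Set.univ := by
  rintro rfl
  obtain ⟨ψ, hψ, hmaps, hright⟩ := h.exists_continuousOn_inv
  have himg : ψ '' Set.univ = Metric.ball 0 1 := by
    refine hmaps.image_subset.antisymm fun z hz => ⟨φ z, trivial, ?_⟩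
    exact h.injOn (hmaps trivial) hz (hright _ trivial)
  have hcl : IsClosed (Metric.ball (0 : ℂ) 1) := by
    rw [← himg]
    exact (isCompact_univ.image_of_continuousOn hψ).isClosed
  have h1 : (1 : ℂ) ∈ closure (Metric.ball (0 : ℂ) 1) := by
    rw [closure_ball _ one_ne_zero]
    simp
  rw [hcl.closure_eq] at h1
  simp at h1

lemma isSimplyConnected_unitBall : IsSimplyConnected (Metric.ball (0 : ℂ) 1) := by
  have := (convex_ball (0 : ℂ) 1).contractibleSpace ⟨0, by simp⟩
  exact SimplyConnectedSpace.ofContractible _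

/-- Square roots lift through the disc. Simple connectivity of pointed discs enters the proof only
in this form. -/
lemma IsRiemannMap.exists_continuousOn_sq_eq {φ : ℂ → Sph} {V : Set Sph} (h : IsRiemannMap φ V)
    {g : Sph → ℂ} (hg : ContinuousOn g V) (hg0 : ∀ w ∈ V, g w ≠ 0) :
    ∃ r : Sph → ℂ, ContinuousOn r V ∧ ∀ w ∈ V, r w ^ 2 = g w := by
  obtain ⟨ψ, hψ, hmaps, hright⟩ := h.exists_continuousOn_inv
  have hφ : Set.MapsTo φ (Metric.ball 0 1) V := fun z hz => h.image_eq ▸ ⟨z, hz, rfl⟩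
  obtain ⟨f, hf, hfsq⟩ := Complex.exists_continuousOn_pow_eq (U := Metric.ball (0 : ℂ) 1)
    isSimplyConnected_unitBall Metric.isOpen_ball (g := g ∘ φ)
    (hg.comp h.continuousOn hφ) (by
      rintro ⟨z, hz, h0⟩
      exact hg0 _ (hφ hz) h0) two_ne_zero
  refine ⟨f ∘ ψ, hf.comp hψ hmaps, fun w hw => ?_⟩
  rw [Function.comp_apply, hfsq, Function.comp_apply, hright w hw]

lemma IsPointedDisc.isOpen {U : Set Sph} {u : Sph} (h : IsPointedDisc U u) : IsOpen U :=
  h.2.choose_spec.isOpen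

lemma IsPointedDisc.isPreconnected {U : Set Sph} {u : Sph} (h : IsPointedDisc U u) :
    IsPreconnected U :=
  h.2.choose_spec.isPreconnected

lemma IsPointedDisc.ne_univ {U : Set Sph} {u : Sph} (h : IsPointedDisc U u) : U ≠ Set.univ :=
  h.2.choose_spec.ne_univ

/-- A disc about infinity whose boundary stays at a fixed distance from infinity contains a fixed
neighbourhood of infinity. -/
lemma exists_forall_mem_of_le_boundaryDist {δ : ℝ} (hδ : 0 < δ) : ∃ R : ℝ, ∀ U : Set Sph,
    IsOpen U → OnePoint.infty ∈ U → δ ≤ boundaryDist U OnePoint.infty →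
      ∀ z : ℂ, R < ‖z‖ → (z : Sph) ∈ U := by
  obtain ⟨η, hη, hη'⟩ := exists_sphDist_lt hδ
  refine ⟨1 / η, fun U hU hinf hb z hz => ?_⟩
  by_contra hzU
  -- The chordal disc about `∞` is connected and misses the frontier of `U`, so it lies in `U` as
  -- soon as it meets `U`, which it does at `∞`.
  have hpc : IsPreconnected (param true '' Metric.ball 0 η) :=
    (convex_ball 0 η).isPreconnected.image _ (isOpenEmbedding_param true).continuous.continuousOn
  have hdisj : ∀ x ∈ frontier U, x ∉ param true '' Metric.ball 0 η := by
    rintro _ hx ⟨y, hy, rfl⟩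
    have hbelow : BddBelow (sphDist OnePoint.infty '' frontier U) := by
      refine ⟨0, ?_⟩
      rintro _ ⟨y, -, rfl⟩
      exact sphDist_nonneg _ _
    have h1 : δ ≤ sphDist OnePoint.infty (param true y) :=
      hb.trans (csInf_le hbelow ⟨_, hx, rfl⟩)
    refine h1.not_gt (hη' _ _ ?_)
    rw [mem_ball_zero_iff] at hy
    by_cases hy0 : y = 0
    · simpa [hy0, param] using hη
    · have : param true y = ((y⁻¹ : ℂ) : Sph) := by simp [param, sphInv_coe, hy0]
      rw [this]
      refine lt_of_le_of_lt ?_ hy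
      have h2 := chordal_coe_infty_le (inv_ne_zero hy0)
      rwa [norm_inv, one_div, inv_inv] at h2
  have hz0 : z ≠ 0 := by
    rintro rfl
    rw [norm_zero] at hz
    exact absurd hz (one_div_pos.2 hη).not_gt
  have hzN : (z : Sph) ∈ param true '' Metric.ball 0 η := by
    refine ⟨z⁻¹, ?_, by simp [param, sphInv_coe, hz0]⟩
    rw [mem_ball_zero_iff, norm_inv]
    rw [div_lt_iff₀ hη] at hz
    rw [inv_lt_iff_one_lt_mul₀ (norm_pos_iff.2 hz0)]
    rwa [mul_comm]
  refine hzU (hpc.subset_of_closure_inter_subset hU ?_ ?_ hzN)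
  · exact ⟨OnePoint.infty, ⟨0, by simpa using hη, by simp [param]⟩, hinf⟩
  · rintro x ⟨hx, hxN⟩
    by_contra hxU
    exact hdisj x ⟨hx, by rwa [hU.interior_eq]⟩ hxN

/-! ### Quadratic polynomials on the sphere -/

@[simp] lemma polyMap_infty (p : ℂ[X]) : polyMap p OnePoint.infty = OnePoint.infty := rfl

@[simp] lemma polyMap_coe (p : ℂ[X]) (z : ℂ) : polyMap p (z : Sph) = ((p.eval z : ℂ) : Sph) := rfl

lemma polyMap_eq_infty {p : ℂ[X]} {z : Sph} : polyMap p z = OnePoint.infty ↔ z = OnePoint.infty := by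
  induction z using OnePoint.rec <;> simp

lemma continuous_polyMap {p : ℂ[X]} (hp : 0 < p.natDegree) : Continuous (polyMap p) := by
  rw [OnePoint.continuous_iff]
  constructor
  · simp only [polyMap_coe, polyMap_infty, tendsto_coe_infty_iff]
    refine p.tendsto_norm_atTop (natDegree_pos_iff_degree_pos.1 hp) ?_
    rw [coclosedCompact_eq_cocompact, ← Metric.cobounded_eq_cocompact]
    exact tendsto_norm_cobounded_atTop
  · exact OnePoint.continuous_coe.comp p.continuous

/-- A quadratic polynomial with critical point `c` and critical value `v`, completed to a square. -/
structure IsQuadratic (p : ℂ[X]) (a c v : ℂ) : Prop where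
  natDegree_eq : p.natDegree = 2
  ne_zero : a ≠ 0
  eval_eq : ∀ z, p.eval z = a * (z - c) ^ 2 + v

lemma exists_isQuadratic {p : ℂ[X]} (hp : p.natDegree = 2) : ∃ a c v, IsQuadratic p a c v := by
  have ha : p.coeff 2 ≠ 0 := by
    rw [← hp]
    exact leadingCoeff_ne_zero.2 fun h => by simp [h] at hp
  refine ⟨p.coeff 2, -p.coeff 1 / (2 * p.coeff 2),
    p.coeff 0 - p.coeff 1 ^ 2 / (4 * p.coeff 2), hp, ha, fun z => ?_⟩
  rw [eval_eq_sum_range, hp]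
  simp only [Finset.sum_range_succ, Finset.sum_range_zero]
  field_simp
  ring

/-- The reflection `z ↦ 2 c - z` of the sphere in the point `c`. -/
noncomputable def reflect (c : ℂ) : Sph → Sph := polyMap (C (2 * c) - X)

@[simp] lemma reflect_infty (c : ℂ) : reflect c OnePoint.infty = OnePoint.infty := rfl

@[simp] lemma reflect_coe (c z : ℂ) : reflect c (z : Sph) = ((2 * c - z : ℂ) : Sph) := by
  simp [reflect]

lemma continuous_reflect (c : ℂ) : Continuous (reflect c) := by
  apply continuous_polyMap
  rw [← neg_sub, natDegree_neg, natDegree_X_sub_C]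
  exact one_pos

namespace IsQuadratic

variable {p : ℂ[X]} {a c v : ℂ}

lemma continuous_polyMap (hp : IsQuadratic p a c v) : Continuous (polyMap p) :=
  NonautDyn.continuous_polyMap (by rw [hp.natDegree_eq]; exact two_pos)

lemma polyMap_reflect (hp : IsQuadratic p a c v) (z : Sph) :
    polyMap p (reflect c z) = polyMap p z := by
  induction z using OnePoint.rec with
  | infty => simp
  | coe z =>
    rw [reflect_coe, polyMap_coe, polyMap_coe, hp.eval_eq, hp.eval_eq]
    congr 1
    ring

lemma eq_or_eq_reflect (hp : IsQuadratic p a c v) {z w : Sph} (h : polyMap p z = polyMap p w) :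
    z = w ∨ z = reflect c w := by
  induction w using OnePoint.rec with
  | infty =>
    rw [polyMap_infty, polyMap_eq_infty] at h
    exact Or.inl h
  | coe w =>
    induction z using OnePoint.rec with
    | infty => simp at h
    | coe z =>
      simp only [polyMap_coe, OnePoint.coe_eq_coe, hp.eval_eq, reflect_coe] at h ⊢
      have h2 : a * ((z - w) * (z - (2 * c - w))) = 0 := by linear_combination h
      rcases mul_eq_zero.1 ((mul_eq_zero.1 h2).resolve_left hp.ne_zero) with h | h
      · exact Or.inl (sub_eq_zero.1 h)
      · exact Or.inr (sub_eq_zero.1 h)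

lemma eq_of_isCriticalPt (hp : IsQuadratic p a c v) {U : Set Sph} {u : Sph}
    (h : IsCriticalPt (polyMap p) U u) : u = (c : Sph) ∨ u = OnePoint.infty := by
  induction u using OnePoint.rec with
  | infty => exact Or.inr rfl
  | coe z =>
    left
    have h1 : deriv (fun z => p.eval z) z = 0 :=
      h.2 false false z ⟨h.1, OnePoint.coe_ne_infty _⟩ rfl
    have h2 : HasDerivAt (fun z => p.eval z) (2 * a * (z - c)) z := by
      have : (fun z => p.eval z) = fun z => a * (z - c) ^ 2 + v := funext hp.eval_eq
      rw [this]
      refine HasDerivAt.congr_deriv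
        ((((hasDerivAt_id z).sub_const c).pow 2).const_mul a |>.add_const v) ?_
      simp only [id_eq, Nat.cast_ofNat]
      ring
    rw [h2.deriv] at h1
    have h3 := (mul_eq_zero.1 h1).resolve_left (mul_ne_zero two_ne_zero hp.ne_zero)
    rw [sub_eq_zero.1 h3]

variable {U V : Set Sph}

/-- A disc invariant under the reflection in `c` does not contain both fixed points `c`, `∞`. -/
lemma _root_.NonautDyn.IsPointedDisc.infty_notMem_of_reflect {U : Set Sph} {u : Sph}
    (hU : IsPointedDisc U u) {c : ℂ} (href : ∀ z ∈ U, reflect c z ∈ U) (hc : (c : Sph) ∈ U) :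
    OnePoint.infty ∉ U := by
  intro hinf
  obtain ⟨x, hx⟩ := (Set.ne_univ_iff_exists_notMem U).1 hU.ne_univ
  obtain ⟨e, rfl⟩ := OnePoint.ne_infty_iff_exists.1 fun h : x = OnePoint.infty => hx (h ▸ hinf)
  have hce : e - c ≠ 0 := fun h => hx (by rwa [sub_eq_zero.1 h])
  have he : ∀ z : ℂ, (z : Sph) ∈ U → z - e ≠ 0 :=
    fun z hz h => hx (by rwa [← sub_eq_zero.1 h])
  have he' : ∀ z : ℂ, (z : Sph) ∈ U → z - (2 * c - e) ≠ 0 := fun z hz h => hx (by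
    have := href _ hz
    rw [sub_eq_zero.1 h, reflect_coe] at this
    simpa using this)
  -- The Möbius map with pole `e` and zero at the reflection of `e`, both outside `U`, has a
  -- continuous square root `r` on `U`. Reflection turns `M` into `1 / M`, so `r` times its
  -- reflection takes only the values `1` and `-1`. It equals `M c = -1` at `c` and `M ∞ = 1` at
  -- `∞`, which contradicts connectedness.
  let M : Sph → ℂ := fun w => w.elim 1 fun z => (z - (2 * c - e)) / (z - e)
  have hMinf : M OnePoint.infty = 1 := rfl
  have hMcoe : ∀ z : ℂ, M z = (z - (2 * c - e)) / (z - e) := fun z => rfl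
  have hMcont : ContinuousOn M U := by
    intro w hw
    refine ContinuousAt.continuousWithinAt ?_
    induction w using OnePoint.rec with
    | infty =>
      rw [OnePoint.continuousAt_infty', hMinf, coclosedCompact_eq_cocompact,
        ← Metric.cobounded_eq_cocompact]
      have h1 : Tendsto (fun z : ℂ => 1 + 2 * (e - c) * (z - e)⁻¹) (Bornology.cobounded ℂ)
          (𝓝 (1 + 2 * (e - c) * 0)) :=
        ((tendsto_inv₀_cobounded.comp
          (tendsto_sub_const_cobounded e)).const_mul _).const_add _
      rw [mul_zero, add_zero] at h1
      refine h1.congr' ?_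
      filter_upwards [Bornology.eventually_ne_cobounded e] with z hz
      have : z - e ≠ 0 := sub_ne_zero.2 hz
      rw [Function.comp_apply, hMcoe]
      field_simp
      ring
    | coe z =>
      rw [OnePoint.continuousAt_coe]
      change ContinuousAt (fun z : ℂ => (z - (2 * c - e)) / (z - e)) z
      exact ContinuousAt.div (by fun_prop) (by fun_prop) (he z hw)
  have hM0 : ∀ w ∈ U, M w ≠ 0 := by
    intro w hw
    induction w using OnePoint.rec with
    | infty => exact one_ne_zero
    | coe z => exact div_ne_zero (he' z hw) (he z hw)
  have hMref : ∀ w ∈ U, M w * M (reflect c w) = 1 := by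
    intro w hw
    induction w using OnePoint.rec with
    | infty => rw [reflect_infty, hMinf, one_mul]
    | coe z =>
      rw [reflect_coe, hMcoe, hMcoe]
      have h1 := he z hw
      have h2 := he' z hw
      have h3 : 2 * c - z - e ≠ 0 := fun h => h2 (by linear_combination -h)
      field_simp
      ring
  obtain ⟨φ, hφ⟩ := hU.2
  obtain ⟨r, hr, hrsq⟩ := hφ.exists_continuousOn_sq_eq hMcont hM0
  have hs : ContinuousOn (fun w => (r w * r (reflect c w)).re) U :=
    Complex.continuous_re.comp_continuousOn
      (hr.mul (hr.comp (continuous_reflect c).continuousOn href))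
  have hc1 : (r c * r (reflect c c)).re = -1 := by
    have h1 : reflect c c = (c : Sph) := by rw [reflect_coe]; congr 1; ring
    rw [h1, ← sq, hrsq _ hc, hMcoe]
    have h3 : (c - (2 * c - e)) / (c - e) = -1 := by
      rw [div_eq_iff (he c hc)]
      ring
    rw [h3]
    simp
  have hinf1 : (r OnePoint.infty * r (reflect c OnePoint.infty)).re = 1 := by
    rw [reflect_infty, ← sq, hrsq _ hinf, hMinf, Complex.one_re]
  obtain ⟨w, hw, hw0⟩ := hU.isPreconnected.intermediate_value hc hinf hs
    (show (0 : ℝ) ∈ Set.Icc _ _ by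
      simp only [hc1, hinf1]
      constructor <;> norm_num)
  have h1 : (r w * r (reflect c w)) ^ 2 = 1 := by
    rw [mul_pow, hrsq _ hw, hrsq _ (href _ hw), hMref _ hw]
  simp only at hw0
  rcases mul_self_eq_one_iff.1 ((sq _).symm.trans h1) with h | h <;> rw [h] at hw0 <;> norm_num at hw0

/-- The domain of a proper restriction of full degree is invariant under the reflection. -/
lemma reflect_mem (hp : IsQuadratic p a c v) (hU : IsOpen U) (hUc : IsPreconnected U)
    (hV : IsOpen V) (h : IsProperOfDegree (polyMap p) U V 2) {z : Sph} (hz : z ∈ U) :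
    reflect c z ∈ U := by
  have hcont := hp.continuous_polyMap
  have hopen : IsOpen (U ∩ reflect c ⁻¹' U) := hU.inter (hU.preimage (continuous_reflect c))
  -- The points of `U` whose reflection is in `U` form an open and relatively closed subset. It is
  -- nonempty because a fibre with two points is a reflected pair; it is relatively closed because,
  -- by properness, reflections of points near `x` stay in a compact part of `U`.
  refine (hUc.subset_of_closure_inter_subset hopen ?_ ?_ hz).2
  · obtain ⟨w, -, hw⟩ := h.fibre_eq
    obtain ⟨x, y, hxy, hset⟩ := Set.ncard_eq_two.1 hw
    have hx : x ∈ U ∩ polyMap p ⁻¹' {w} := by rw [hset]; simp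
    have hy : y ∈ U ∩ polyMap p ⁻¹' {w} := by rw [hset]; simp
    have hyx : y = reflect c x :=
      (hp.eq_or_eq_reflect (hy.2.trans hx.2.symm)).resolve_left hxy.symm
    exact ⟨x, hx.1, hx.1, by rw [Set.mem_preimage, ← hyx]; exact hy.1⟩
  · rintro x ⟨hx, hxU⟩
    refine ⟨hxU, ?_⟩
    have hfx : polyMap p x ∈ V := h.image_eq ▸ ⟨x, hxU, rfl⟩
    obtain ⟨K, hK, hxK, hKV⟩ := exists_compact_subset hV hfx
    have hclosed : IsClosed (U ∩ polyMap p ⁻¹' K) := (h.proper K hK hKV).isClosed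
    have hx' : x ∈ closure ((polyMap p ⁻¹' interior K) ∩ (U ∩ reflect c ⁻¹' U)) :=
      (isOpen_interior.preimage hcont).inter_closure ⟨hxK, hx⟩
    have hsub : (polyMap p ⁻¹' interior K) ∩ (U ∩ reflect c ⁻¹' U) ⊆
        reflect c ⁻¹' (U ∩ polyMap p ⁻¹' K) := by
      rintro y ⟨hyK, -, hyU⟩
      refine ⟨hyU, ?_⟩
      rw [Set.mem_preimage, hp.polyMap_reflect]
      exact interior_subset hyK
    exact (closure_minimal hsub (hclosed.preimage (continuous_reflect c)) hx').1

lemma mem_of_polyMap_mem (hp : IsQuadratic p a c v) (hU : IsOpen U) (hUc : IsPreconnected U)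
    (hV : IsOpen V) (h : IsProperOfDegree (polyMap p) U V 2) {z : Sph} (hz : polyMap p z ∈ V) :
    z ∈ U := by
  rw [← h.image_eq] at hz
  obtain ⟨w, hw, hwz⟩ := hz
  rcases hp.eq_or_eq_reflect hwz.symm with rfl | rfl
  · exact hw
  · exact hp.reflect_mem hU hUc hV h hw

end IsQuadratic

/-! ### Iteration and normality -/

lemma compFrom_succ_apply {X : Type*} (f : ℕ → X → X) (m k : ℕ) (x : X) :
    compFrom f m (k + 1) x = f (m + k + 1) (compFrom f m k x) := rfl

lemma compFrom_succ_apply' {X : Type*} (f : ℕ → X → X) (m k : ℕ) (x : X) :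
    compFrom f m (k + 1) x = compFrom f (m + 1) k (f (m + 1) x) := by
  induction k with
  | zero => rfl
  | succ k ih =>
    rw [compFrom_succ_apply, ih, compFrom_succ_apply, show m + (k + 1) + 1 = m + 1 + k + 1 by ring]

@[simp] lemma compFrom_polyMap_coe (P : ℕ → ℂ[X]) (m k : ℕ) (z : ℂ) :
    compFrom (fun i => polyMap (P i)) m k (z : Sph) =
      ((compFrom (fun i z => (P i).eval z) m k z : ℂ) : Sph) := by
  induction k with
  | zero => rfl
  | succ k ih => rw [compFrom_succ_apply, ih, polyMap_coe, compFrom_succ_apply]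

@[simp] lemma compFrom_polyMap_infty (P : ℕ → ℂ[X]) (m k : ℕ) :
    compFrom (fun i => polyMap (P i)) m k OnePoint.infty = OnePoint.infty := by
  induction k with
  | zero => rfl
  | succ k ih => rw [compFrom_succ_apply, ih, polyMap_infty]

lemma continuous_compFrom_eval (P : ℕ → ℂ[X]) (m k : ℕ) :
    Continuous (compFrom (fun i z => (P i).eval z) m k) := by
  induction k with
  | zero => exact continuous_id
  | succ k ih => exact (P _).continuous.comp ih

/-- A sequence which converges uniformly on a set forms a normal family there. -/
lemma isNormalOn_of_forall_eventually {F : ℕ → Sph → Sph} {N : Set Sph} {g : Sph → Sph}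
    (h : ∀ ε > 0, ∀ᶠ n in atTop, ∀ x ∈ N, sphDist (F n x) (g x) < ε) : IsNormalOn F N := by
  intro k
  -- An arbitrary choice of indices either tends to infinity or takes one value infinitely often; in
  -- the latter case a constant subsequence converges.
  by_cases hk : Tendsto k atTop atTop
  · refine ⟨id, strictMono_id, g, fun C _ hCN ε hε => ?_⟩
    filter_upwards [hk.eventually (h ε hε)] with i hi x hx
    exact hi x (hCN hx)
  · obtain ⟨b, hb⟩ : ∃ b, ∃ᶠ i in atTop, k i < b := by
      by_contra! hcon
      exact hk (tendsto_atTop.2 hcon)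
    obtain ⟨v, hv⟩ : ∃ v, ∃ᶠ i in atTop, k i = v := by
      by_contra! hcon
      refine hb ?_
      have : ∀ᶠ i in atTop, ∀ v ∈ Finset.range b, k i ≠ v :=
        (Finset.eventually_all _).2 fun v _ => hcon v
      filter_upwards [this] with i hi hib
      exact hi _ (Finset.mem_range.2 hib) rfl
    obtain ⟨s, hs, hsv⟩ := extraction_of_frequently_atTop hv
    refine ⟨s, hs, F v, fun C _ _ ε hε => Eventually.of_forall fun i x _ => ?_⟩
    rwa [hsv, sphDist_self]

lemma mem_fatou_of_forall_eventually_lt_norm {P : ℕ → ℂ[X]} {m : ℕ} {N : Set Sph} (hN : IsOpen N)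
    {x : Sph} (hx : x ∈ N)
    (h : ∀ R : ℝ, ∀ᶠ n in atTop, ∀ z : ℂ, (z : Sph) ∈ N →
      R < ‖compFrom (fun i z => (P i).eval z) m n z‖) : x ∈ fatou P m := by
  refine ⟨N, hN, hx, isNormalOn_of_forall_eventually (g := fun _ => OnePoint.infty) ?_⟩
  intro ε hε
  obtain ⟨δ, hδ, hδε⟩ := exists_sphDist_lt hε
  filter_upwards [h (1 / δ)] with n hn x hx
  induction x using OnePoint.rec with
  | infty => rwa [compFrom_polyMap_infty, sphDist_self]
  | coe z =>
    rw [compFrom_polyMap_coe]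
    have h1 := hn z hx
    have h2 : 0 < ‖compFrom (fun i z => (P i).eval z) m n z‖ := (one_div_pos.2 hδ).trans h1
    exact hδε _ _ ((chordal_coe_infty_le (norm_pos_iff.1 h2)).trans_lt
      ((one_div_lt h2 hδ).2 h1))

/-! ### Quadratic polynomials with a fixed critical point -/

namespace IsQuadratic

variable {p : ℂ[X]} {a c : ℂ}

/-- The coordinate `a * (z - c)` conjugates the polynomial to squaring. -/
lemma norm_mul_compFrom_sub (hp : IsQuadratic p a c c) (n : ℕ) (z : ℂ) :
    ‖a‖ * ‖compFrom (fun _ z => p.eval z) 0 n z - c‖ = (‖a‖ * ‖z - c‖) ^ 2 ^ n := by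
  induction n with
  | zero => simp [compFrom]
  | succ n ih =>
    rw [compFrom_succ_apply, hp.eval_eq, add_sub_cancel_right, norm_mul, norm_pow,
      pow_succ 2 n, pow_mul, ← ih]
    ring

lemma mem_fatou_of_lt_one (hp : IsQuadratic p a c c) {z : ℂ} (hz : ‖a‖ * ‖z - c‖ < 1) :
    (z : Sph) ∈ fatou (fun _ => p) 0 := by
  have ha : 0 < ‖a‖ := norm_pos_iff.2 hp.ne_zero
  obtain ⟨r, hzr, hr1⟩ := exists_between hz
  have hr0 : 0 ≤ r := (by positivity : 0 ≤ ‖a‖ * ‖z - c‖).trans hzr.le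
  have hopen : IsOpen {z : ℂ | ‖a‖ * ‖z - c‖ < r} := isOpen_lt (by fun_prop) continuous_const
  refine ⟨(↑) '' {z : ℂ | ‖a‖ * ‖z - c‖ < r}, OnePoint.isOpen_image_coe.2 hopen, ⟨z, hzr, rfl⟩,
    isNormalOn_of_forall_eventually (g := fun _ => (c : Sph)) fun ε hε => ?_⟩
  obtain ⟨δ, hδ, hδε⟩ := exists_sphDist_lt hε
  have h1 : Tendsto (fun n : ℕ => r ^ 2 ^ n) atTop (𝓝 0) :=
    (tendsto_pow_atTop_nhds_zero_of_lt_one hr0 hr1).comp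
      (tendsto_pow_atTop_atTop_of_one_lt one_lt_two)
  filter_upwards [h1.eventually_lt_const (show 0 < ‖a‖ * δ by positivity)] with n hn
  rintro _ ⟨w, hw, rfl⟩
  rw [compFrom_polyMap_coe]
  refine hδε _ _ ((chordal_coe_le _ _).trans_lt ?_)
  refine lt_of_mul_lt_mul_left (lt_of_le_of_lt ?_ hn) ha.le
  rw [hp.norm_mul_compFrom_sub]
  have : ‖a‖ * ‖w - c‖ < r := hw
  gcongr

lemma mem_fatou_of_isOpen (hp : IsQuadratic p a c c) {r : ℝ} (hr : 1 < r) {x : Sph} {N : Set Sph}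
    (hN : IsOpen N) (hx : x ∈ N) (h : ∀ z : ℂ, (z : Sph) ∈ N → r < ‖a‖ * ‖z - c‖) :
    x ∈ fatou (fun _ => p) 0 := by
  have ha : 0 < ‖a‖ := norm_pos_iff.2 hp.ne_zero
  refine mem_fatou_of_forall_eventually_lt_norm hN hx fun R => ?_
  have h1 : Tendsto (fun n : ℕ => r ^ 2 ^ n) atTop atTop :=
    (tendsto_pow_atTop_atTop_of_one_lt hr).comp
      (tendsto_pow_atTop_atTop_of_one_lt one_lt_two)
  filter_upwards [h1.eventually_gt_atTop (‖a‖ * (R + ‖c‖))] with n hn z hz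
  have h2 : ‖a‖ * (R + ‖c‖) < ‖a‖ * ‖compFrom (fun _ z => p.eval z) 0 n z - c‖ := by
    rw [hp.norm_mul_compFrom_sub]
    refine hn.trans_le ?_
    have := (h z hz).le
    gcongr
  have h3 := lt_of_mul_lt_mul_left h2 ha.le
  have h4 := norm_sub_le (compFrom (fun _ z => p.eval z) 0 n z) c
  linarith

lemma mem_fatou_of_one_lt (hp : IsQuadratic p a c c) {z : ℂ} (hz : 1 < ‖a‖ * ‖z - c‖) :
    (z : Sph) ∈ fatou (fun _ => p) 0 := by
  obtain ⟨r, hr1, hzr⟩ := exists_between hz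
  have hopen : IsOpen {z : ℂ | r < ‖a‖ * ‖z - c‖} := isOpen_lt continuous_const (by fun_prop)
  refine hp.mem_fatou_of_isOpen hr1 (OnePoint.isOpen_image_coe.2 hopen) ⟨z, hzr, rfl⟩ ?_
  rintro w ⟨w', hw', h⟩
  rwa [← OnePoint.coe_eq_coe.1 h]

lemma infty_mem_fatou (hp : IsQuadratic p a c c) : OnePoint.infty ∈ fatou (fun _ => p) 0 := by
  have ha : 0 < ‖a‖ := norm_pos_iff.2 hp.ne_zero
  refine hp.mem_fatou_of_isOpen (r := 2) one_lt_two (N := ((↑) '' Metric.closedBall c (2 / ‖a‖))ᶜ)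
    (OnePoint.isOpen_compl_image_coe.2 ⟨Metric.isClosed_closedBall, isCompact_closedBall _ _⟩)
    OnePoint.infty_notMem_image_coe fun z hz => ?_
  by_contra! hle
  refine hz ⟨z, ?_, rfl⟩
  rw [Metric.mem_closedBall, dist_eq_norm, le_div_iff₀ ha, mul_comm]
  exact hle

/-- The circle is invariant, while points inside it converge to `c`. A uniform limit near a point of
the circle would have to bring its iterates close to `c`. -/
lemma notMem_fatou_of_eq_one (hp : IsQuadratic p a c c) {z : ℂ} (hz : ‖a‖ * ‖z - c‖ = 1) :
    (z : Sph) ∉ fatou (fun _ => p) 0 := by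
  have ha : 0 < ‖a‖ := norm_pos_iff.2 hp.ne_zero
  rintro ⟨N, hN, hzN, hnorm⟩
  set f := fun n => compFrom (fun _ z => p.eval z) 0 n with hf
  have hfsub : ∀ n w, ‖a‖ * ‖f n w - c‖ = (‖a‖ * ‖w - c‖) ^ 2 ^ n := hp.norm_mul_compFrom_sub
  obtain ⟨s, hs, g, hg⟩ := hnorm id
  have hN' : IsOpen ((↑) ⁻¹' N : Set ℂ) := hN.preimage OnePoint.continuous_coe
  obtain ⟨ρ, hρ, hball⟩ := Metric.nhds_basis_closedBall.mem_iff.1 (hN'.mem_nhds hzN)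
  have hlim : ∀ ε > 0, ∀ᶠ i in atTop, ∀ x ∈ Metric.closedBall z ρ,
      sphDist (f (s i) x : ℂ) (g (x : Sph)) < ε := by
    intro ε hε
    have := hg _ ((isCompact_closedBall z ρ).image OnePoint.continuous_coe)
      (Set.image_subset_iff.2 hball) ε hε
    filter_upwards [this] with i hi x hx
    have := hi _ (Set.mem_image_of_mem _ hx)
    rwa [id, compFrom_polyMap_coe] at this
  have hgx : ∀ x ∈ Metric.closedBall z ρ, ‖a‖ * ‖x - c‖ < 1 → g (x : Sph) = (c : Sph) := by
    intro x hx hx1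
    have h1 : Tendsto (fun i => ‖f (s i) x - c‖) atTop (𝓝 0) := by
      have h2 : Tendsto (fun n : ℕ => (‖a‖ * ‖x - c‖) ^ 2 ^ n) atTop (𝓝 0) :=
        (tendsto_pow_atTop_nhds_zero_of_lt_one (by positivity) hx1).comp
          (tendsto_pow_atTop_atTop_of_one_lt one_lt_two)
      have h3 := (h2.comp hs.tendsto_atTop).const_mul ‖a‖⁻¹
      rw [mul_zero] at h3
      refine h3.congr fun i => ?_
      rw [Function.comp_apply, ← hfsub, inv_mul_cancel_left₀ ha.ne']
    have h2 : Tendsto (fun i => f (s i) x) atTop (𝓝 c) := tendsto_iff_norm_sub_tendsto_zero.2 h1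
    have h3 := ((continuous_sphDist_coe (g (x : Sph))).tendsto c).comp h2
    have h4 : sphDist (c : Sph) (g (x : Sph)) ≤ 0 := by
      refine le_of_forall_pos_le_add fun ε hε => ?_
      rw [zero_add]
      refine le_of_tendsto h3 ?_
      filter_upwards [hlim ε hε] with i hi
      exact (hi x hx).le
    by_contra hne
    exact h4.not_gt (sphDist_pos (Ne.symm hne))
  -- the circle stays at a definite distance from the centre
  set B := √(1 + (‖c‖ + 1 / ‖a‖) ^ 2) * √(1 + ‖c‖ ^ 2) with hB
  have hBpos : 0 < B := by positivity
  have hχ : 0 < 1 / ‖a‖ / B := by positivity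
  set ε := Real.arcsin (1 / ‖a‖ / B) with hε
  have hεpos : 0 < ε := Real.arcsin_pos.2 hχ
  obtain ⟨i, hi⟩ := (hlim (ε / 2) (by positivity)).exists
  -- For a fixed late iterate, the estimate at points inside the circle passes to `z` on the circle
  -- by continuity.
  have hle : sphDist (f (s i) z : ℂ) (c : Sph) ≤ ε / 2 := by
    have hcl : z ∈ closure (Metric.ball c (1 / ‖a‖) ∩ Metric.ball z ρ) := by
      refine Metric.isOpen_ball.closure_inter ⟨?_, Metric.mem_ball_self hρ⟩
      rw [closure_ball _ (by positivity), Metric.mem_closedBall, dist_eq_norm, le_div_iff₀ ha,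
        mul_comm]
      exact hz.le
    have hclosed : IsClosed {x : ℂ | sphDist (f (s i) x : ℂ) (c : Sph) ≤ ε / 2} :=
      isClosed_le ((continuous_sphDist_coe _).comp (continuous_compFrom_eval _ 0 (s i)))
        continuous_const
    refine closure_minimal ?_ hclosed hcl
    rintro x ⟨hx1, hx2⟩
    have hx2' := Metric.ball_subset_closedBall hx2
    have h1 : ‖a‖ * ‖x - c‖ < 1 := by
      rwa [Metric.mem_ball, dist_eq_norm, lt_div_iff₀ ha, mul_comm] at hx1
    have h2 := hi x hx2'
    rw [hgx x hx2' h1] at h2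
    exact h2.le
  have hge : ε ≤ sphDist (f (s i) z : ℂ) (c : Sph) := by
    refine Real.monotone_arcsin ?_
    have h1 : ‖f (s i) z - c‖ = 1 / ‖a‖ := by
      rw [eq_div_iff ha.ne', mul_comm, hfsub, hz, one_pow]
    have h2 : ‖f (s i) z‖ ≤ ‖c‖ + 1 / ‖a‖ := by
      rw [← h1]
      have := norm_add_le c (f (s i) z - c)
      rwa [add_sub_cancel] at this
    rw [chordal_coe_coe, h1, hB]
    gcongr
  linarith

/-- The Julia set of a quadratic polynomial with a fixed critical point is a circle. -/
lemma julia_eq (hp : IsQuadratic p a c c) :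
    julia (fun _ => p) 0 = (↑) '' Metric.sphere c (1 / ‖a‖) := by
  have ha : 0 < ‖a‖ := norm_pos_iff.2 hp.ne_zero
  have hiff : ∀ z : ℂ, z ∈ Metric.sphere c (1 / ‖a‖) ↔ ‖a‖ * ‖z - c‖ = 1 := fun z => by
    rw [mem_sphere_iff_norm, eq_div_iff ha.ne', mul_comm]
  ext x
  induction x using OnePoint.rec with
  | infty =>
    exact iff_of_false (fun h => h hp.infty_mem_fatou) OnePoint.infty_notMem_image_coe
  | coe z =>
    rw [OnePoint.coe_injective.mem_set_image, hiff]
    constructor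
    · intro h
      rcases lt_trichotomy (‖a‖ * ‖z - c‖) 1 with h1 | h1 | h1
      · exact absurd (hp.mem_fatou_of_lt_one h1) h
      · exact h1
      · exact absurd (hp.mem_fatou_of_one_lt h1) h
    · exact hp.notMem_fatou_of_eq_one

lemma isPreconnected_julia (hp : IsQuadratic p a c c) : IsPreconnected (julia (fun _ => p) 0) := by
  rw [hp.julia_eq]
  exact (isPreconnected_sphere (by rw [Complex.rank_real_complex]; exact Cardinal.one_lt_two)
    c _).image _ OnePoint.continuous_coe.continuousOn

end IsQuadratic

/-! ### The sequence `z ^ 2`, with `(z - 3) ^ 2` at sparse times -/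

/-- The times at which the polynomial is `(z - 3) ^ 2`. -/
def IsShiftTime (m : ℕ) : Prop := ∃ j : ℕ, 1 ≤ j ∧ m + 1 = (j + 1) * (j + 2) / 2

lemma add_one_eq_half_iff {m j : ℕ} :
    m + 1 = (j + 1) * (j + 2) / 2 ↔ 2 * (m + 1) = (j + 1) * (j + 2) := by
  have h : Even ((j + 1) * (j + 2)) := Nat.even_mul_succ_self (j + 1)
  obtain ⟨r, hr⟩ := h
  omega

/-- Consecutive values of `(j + 1) * (j + 2) / 2` differ by `j + 2`, so `j + 1` steps without shift
follow the shift time of index `j`. -/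
lemma not_isShiftTime_add {k j i : ℕ} (hk : 2 * (k + 1) = (j + 1) * (j + 2)) (hi : 1 ≤ i)
    (hij : i ≤ j + 1) : ¬ IsShiftTime (k + i) := by
  rintro ⟨l, -, hl⟩
  rw [add_one_eq_half_iff] at hl
  rcases le_or_gt l j with h | h
  · have : (l + 1) * (l + 2) ≤ (j + 1) * (j + 2) := Nat.mul_le_mul (by omega) (by omega)
    omega
  · have : (j + 2) * (j + 3) ≤ (l + 1) * (l + 2) := Nat.mul_le_mul (by omega) (by omega)
    have h2 : (j + 2) * (j + 3) = (j + 1) * (j + 2) + 2 * (j + 2) := by ring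
    omega

lemma IsShiftTime.not_add_one {k : ℕ} (hk : IsShiftTime k) : ¬ IsShiftTime (k + 1) := by
  obtain ⟨j, hj, h⟩ := hk
  exact not_isShiftTime_add (add_one_eq_half_iff.1 h) le_rfl (by omega)

lemma IsShiftTime.not_add_two {k : ℕ} (hk : IsShiftTime k) : ¬ IsShiftTime (k + 2) := by
  obtain ⟨j, hj, h⟩ := hk
  exact not_isShiftTime_add (add_one_eq_half_iff.1 h) one_le_two (by omega)

lemma exists_le_two_mul_eq (m : ℕ) : ∃ k ≥ m, 2 * (k + 1) = (m + 2) * (m + 3) := by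
  obtain ⟨r, hr⟩ := Nat.even_mul_succ_self (m + 2)
  have hr' : (m + 2) * (m + 3) = r + r := hr
  have h : (m + 2) * 3 ≤ (m + 2) * (m + 3) := Nat.mul_le_mul_left _ (by omega)
  exact ⟨r - 1, by omega, by omega⟩

lemma exists_isShiftTime_ge (m : ℕ) : ∃ k ≥ m, IsShiftTime k := by
  obtain ⟨k, hk, h⟩ := exists_le_two_mul_eq m
  exact ⟨k, hk, m + 1, by omega, add_one_eq_half_iff.2 h⟩

lemma exists_not_isShiftTime_run (m : ℕ) :
    ∃ k ≥ m, ¬ IsShiftTime (k + 1) ∧ ¬ IsShiftTime (k + 2) := by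
  obtain ⟨k, hk, h⟩ := exists_isShiftTime_ge m
  exact ⟨k, hk, h.not_add_one, h.not_add_two⟩

/-- Backward induction from the shift times. -/
lemma shiftTime_induction {motive : ℕ → Prop} (base : ∀ m, IsShiftTime (m + 1) → motive m)
    (step : ∀ m, ¬ IsShiftTime (m + 1) → motive (m + 1) → motive m) (m : ℕ) : motive m := by
  have key : ∀ d m, IsShiftTime (m + d + 1) → motive m := by
    intro d
    induction d with
    | zero => exact base
    | succ d ih =>
      intro m hm
      by_cases h : IsShiftTime (m + 1)
      · exact base m h
      · exact step m h (ih (m + 1) (by rwa [show m + 1 + d + 1 = m + (d + 1) + 1 by ring]))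
  obtain ⟨k, hk, h⟩ := exists_isShiftTime_ge (m + 1)
  exact key (k - (m + 1)) m (by rwa [show m + (k - (m + 1)) + 1 = k by omega])

open Classical in
/-- The polynomial `(z - 3) ^ 2` at the shift times, and `z ^ 2` otherwise. -/
noncomputable def shiftSeq (m : ℕ) : ℂ[X] := if IsShiftTime m then (X - C 3) ^ 2 else X ^ 2

open Classical in
/-- The critical point of `shiftSeq m`. -/
noncomputable def shiftCenter (m : ℕ) : ℂ := if IsShiftTime m then 3 else 0

lemma shiftSeq_of_isShiftTime {m : ℕ} (h : IsShiftTime m) : shiftSeq m = (X - C 3) ^ 2 := if_pos h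

lemma shiftSeq_of_not {m : ℕ} (h : ¬ IsShiftTime m) : shiftSeq m = X ^ 2 := if_neg h

lemma shiftCenter_of_isShiftTime {m : ℕ} (h : IsShiftTime m) : shiftCenter m = 3 := if_pos h

lemma shiftCenter_of_not {m : ℕ} (h : ¬ IsShiftTime m) : shiftCenter m = 0 := if_neg h

lemma norm_shiftCenter_le (m : ℕ) : ‖shiftCenter m‖ ≤ 3 := by
  by_cases h : IsShiftTime m
  · simp [shiftCenter_of_isShiftTime h]
  · simp [shiftCenter_of_not h]

lemma shiftSeq_eq (m : ℕ) : shiftSeq m = (X - C (shiftCenter m)) ^ 2 := by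
  by_cases h : IsShiftTime m
  · rw [shiftSeq_of_isShiftTime h, shiftCenter_of_isShiftTime h]
  · rw [shiftSeq_of_not h, shiftCenter_of_not h, C_0, sub_zero]

lemma eval_shiftSeq (m : ℕ) (z : ℂ) : (shiftSeq m).eval z = (z - shiftCenter m) ^ 2 := by
  simp [shiftSeq_eq]

lemma monic_shiftSeq (m : ℕ) : (shiftSeq m).Monic := by
  rw [shiftSeq_eq]
  exact (monic_X_sub_C _).pow 2

lemma natDegree_shiftSeq (m : ℕ) : (shiftSeq m).natDegree = 2 := by
  rw [shiftSeq_eq, natDegree_pow, natDegree_X_sub_C]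

lemma isQuadratic_shiftSeq (m : ℕ) : IsQuadratic (shiftSeq m) 1 (shiftCenter m) 0 :=
  ⟨natDegree_shiftSeq m, one_ne_zero, fun z => by rw [eval_shiftSeq, one_mul, add_zero]⟩

lemma isBoundedSeq_shiftSeq : IsBoundedSeq shiftSeq := by
  refine ⟨2, 9, 2, le_rfl, by norm_num, one_le_two, fun m _ => ?_⟩
  rw [(monic_shiftSeq m).leadingCoeff, natDegree_shiftSeq, norm_one]
  refine ⟨le_rfl, le_rfl, by norm_num, by norm_num, fun k hk => ?_⟩
  have h := norm_shiftCenter_le m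
  have heq : shiftSeq m = X ^ 2 - C (2 * shiftCenter m) * X + C (shiftCenter m ^ 2) := by
    rw [shiftSeq_eq, C_mul, C_pow, show (C (2 : ℂ)) = 2 from rfl]
    ring
  rw [heq]
  interval_cases k
  · simp only [coeff_add, coeff_sub, coeff_X_pow, coeff_C_mul, coeff_X, coeff_C]
    norm_num
    nlinarith [norm_nonneg (shiftCenter m)]
  · simp only [coeff_add, coeff_sub, coeff_X_pow, coeff_C_mul, coeff_X, coeff_C]
    norm_num
    linarith

/-! ### Escape -/

/-- The composition of the polynomials `shiftSeq` on the plane from time `m` to time `m + k`. -/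
noncomputable abbrev shiftIter (m k : ℕ) : ℂ → ℂ :=
  compFrom (fun i z => (shiftSeq i).eval z) m k

lemma compFrom_add_apply {X : Type*} (f : ℕ → X → X) (m k n : ℕ) (x : X) :
    compFrom f m (k + n) x = compFrom f (m + k) n (compFrom f m k x) := by
  induction n with
  | zero => rfl
  | succ n ih => rw [← add_assoc, compFrom_succ_apply, compFrom_succ_apply, ih, add_assoc m k n]

/-- The radius comes from `(x - 3) ^ 2 - 4 * x = (x - 1) * (x - 9)`. -/
lemma four_mul_norm_le_norm_eval {z : ℂ} (hz : 9 ≤ ‖z‖) (m : ℕ) :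
    4 * ‖z‖ ≤ ‖(shiftSeq m).eval z‖ := by
  rw [eval_shiftSeq, norm_pow]
  have h1 := norm_shiftCenter_le m
  have h2 := norm_sub_norm_le z (shiftCenter m)
  nlinarith

lemma four_pow_mul_norm_le {z : ℂ} (hz : 9 ≤ ‖z‖) (m n : ℕ) :
    4 ^ n * ‖z‖ ≤ ‖shiftIter m n z‖ := by
  induction n with
  | zero => simp [shiftIter, compFrom]
  | succ n ih =>
    have h : ‖z‖ ≤ 4 ^ n * ‖z‖ := le_mul_of_one_le_left (norm_nonneg _) (one_le_pow₀ (by norm_num))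
    have := four_mul_norm_le_norm_eval ((hz.trans h).trans ih) (m + n + 1)
    rw [shiftIter, compFrom_succ_apply, pow_succ]
    linarith

lemma tendsto_norm_shiftIter {m k : ℕ} {z : ℂ} (h : 9 ≤ ‖shiftIter m k z‖) :
    Tendsto (fun n => ‖shiftIter m n z‖) atTop atTop := by
  rw [← tendsto_add_atTop_iff_nat k]
  refine tendsto_atTop_mono (fun n => ?_) (tendsto_pow_atTop_atTop_of_one_lt
    (by norm_num : (1 : ℝ) < 4))
  rw [add_comm, shiftIter, compFrom_add_apply]
  refine le_trans ?_ (four_pow_mul_norm_le h (m + k) n)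
  exact le_mul_of_one_le_right (by positivity) (by linarith)

/-- The point `0` is fixed by `z ^ 2`, and the next shift sends it to `9`. -/
lemma exists_nine_le_norm_shiftIter_zero (m : ℕ) : ∃ k, 9 ≤ ‖shiftIter m k 0‖ := by
  induction m using shiftTime_induction with
  | base m hm =>
    refine ⟨1, ?_⟩
    rw [shiftIter, compFrom_succ_apply]
    change 9 ≤ ‖(shiftSeq (m + 1)).eval 0‖
    rw [eval_shiftSeq, shiftCenter_of_isShiftTime hm]
    norm_num
  | step m hm ih =>
    obtain ⟨k, hk⟩ := ih
    refine ⟨k + 1, ?_⟩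
    rw [shiftIter, compFrom_succ_apply', eval_shiftSeq, shiftCenter_of_not hm]
    simpa using hk

lemma allCriticalPointsEscape_shiftSeq : AllCriticalPointsEscape shiftSeq := by
  intro m c hc
  have hc' : c = shiftCenter (m + 1) := by
    rw [shiftSeq_eq] at hc
    simpa [derivative_pow, sub_eq_zero] using hc
  obtain ⟨k, hk⟩ := exists_nine_le_norm_shiftIter_zero (m + 1)
  refine tendsto_norm_shiftIter (k := k + 1) ?_
  rw [shiftIter, compFrom_succ_apply', eval_shiftSeq, hc', sub_self, zero_pow two_ne_zero]
  exact hk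

/-- The points whose orbit never leaves the disc of radius `9`. -/
def trapped (m : ℕ) : Set ℂ := {z | ∀ k, ‖shiftIter m k z‖ < 9}

lemma mem_fatou_of_nine_lt {m k : ℕ} {N : Set Sph} (hN : IsOpen N) {x : Sph} (hx : x ∈ N)
    (h : ∀ z : ℂ, (z : Sph) ∈ N → 9 < ‖shiftIter m k z‖) : x ∈ fatou shiftSeq m := by
  refine mem_fatou_of_forall_eventually_lt_norm hN hx fun R => ?_
  have h1 : Tendsto (fun n : ℕ => (4 : ℝ) ^ n) atTop atTop :=
    tendsto_pow_atTop_atTop_of_one_lt (by norm_num)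
  filter_upwards [(tendsto_sub_atTop_nat k).eventually (h1.eventually_gt_atTop R),
    eventually_ge_atTop k] with n hn hkn z hz
  obtain ⟨i, rfl⟩ := Nat.exists_eq_add_of_le hkn
  rw [Nat.add_sub_cancel_left] at hn
  rw [compFrom_add_apply]
  have h2 := h z hz
  have h3 := four_pow_mul_norm_le h2.le (m + k) i
  refine (hn.trans_le ?_).trans_le h3
  exact le_mul_of_one_le_right (by positivity) (by linarith)

lemma julia_shiftSeq_subset (m : ℕ) : julia shiftSeq m ⊆ (↑) '' trapped m := by
  intro x hx
  induction x using OnePoint.rec with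
  | infty =>
    refine absurd (mem_fatou_of_nine_lt (k := 0) (N := ((↑) '' Metric.closedBall (0 : ℂ) 9)ᶜ)
      (OnePoint.isOpen_compl_image_coe.2 ⟨Metric.isClosed_closedBall, isCompact_closedBall _ _⟩)
      OnePoint.infty_notMem_image_coe fun z hz => ?_) hx
    by_contra! hle
    exact hz ⟨z, by simpa [shiftIter, compFrom] using hle, rfl⟩
  | coe z =>
    refine ⟨z, ?_, rfl⟩
    intro k
    by_contra! hk
    have h1 : 9 < ‖shiftIter m (k + 1) z‖ := by
      have := four_mul_norm_le_norm_eval hk (m + k + 1)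
      rw [shiftIter, compFrom_succ_apply]
      linarith
    have hopen : IsOpen {w : ℂ | 9 < ‖shiftIter m (k + 1) w‖} :=
      isOpen_lt continuous_const (continuous_compFrom_eval _ _ _).norm
    refine hx (mem_fatou_of_nine_lt (k := k + 1) (OnePoint.isOpen_image_coe.2 hopen)
      ⟨z, h1, rfl⟩ ?_)
    rintro w ⟨w', hw', h⟩
    rwa [← OnePoint.coe_eq_coe.1 h]

/-! ### Expansion and total disconnectedness -/

lemma eval_mem_trapped {m : ℕ} {z : ℂ} (hz : z ∈ trapped m) :
    (z - shiftCenter (m + 1)) ^ 2 ∈ trapped (m + 1) := by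
  intro k
  have := hz (k + 1)
  rwa [shiftIter, compFrom_succ_apply', eval_shiftSeq] at this

/-- A shift is followed by at least two squarings, so a trapped point satisfies `‖z - 3‖ ^ 8 < 9`,
and `1.32 ^ 8 > 9`. -/
lemma norm_sub_three_le {m : ℕ} (hm : IsShiftTime (m + 1)) {z : ℂ} (hz : z ∈ trapped m) :
    ‖z - 3‖ ≤ 1.32 := by
  have h := hz 3
  have h3 : shiftIter m 3 z = (((z - 3) ^ 2) ^ 2) ^ 2 := by
    change (shiftSeq (m + 2 + 1)).eval ((shiftSeq (m + 1 + 1)).eval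
      ((shiftSeq (m + 0 + 1)).eval z)) = _
    rw [eval_shiftSeq, eval_shiftSeq, eval_shiftSeq, add_zero, shiftCenter_of_isShiftTime hm,
      shiftCenter_of_not hm.not_add_one, shiftCenter_of_not (m := m + 2 + 1) hm.not_add_two,
      sub_zero, sub_zero]
  rw [h3, norm_pow, norm_pow, norm_pow, ← pow_mul, ← pow_mul] at h
  by_contra! hlt
  have : (1.32 : ℝ) ^ (2 * (2 * 2)) ≤ ‖z - 3‖ ^ (2 * (2 * 2)) := by gcongr
  norm_num at this h
  linarith

lemma le_norm_of_isShiftTime {m : ℕ} (hm : IsShiftTime (m + 1)) {z : ℂ} (hz : z ∈ trapped m) :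
    1.68 ≤ ‖z‖ := by
  have h1 := norm_sub_three_le hm hz
  have h2 := norm_sub_norm_le (3 : ℂ) z
  rw [norm_sub_rev] at h2
  norm_num at h1 h2 ⊢
  linarith

lemma one_lt_norm_of_mem_trapped {m : ℕ} {z : ℂ} (hz : z ∈ trapped m) : 1 < ‖z‖ := by
  induction m using shiftTime_induction generalizing z with
  | base m hm =>
    have := le_norm_of_isShiftTime hm hz
    norm_num at this
    linarith
  | step m hm ih =>
    have := ih (eval_mem_trapped hz)
    rw [shiftCenter_of_not hm, sub_zero, norm_pow] at this
    exact (one_lt_pow_iff_of_nonneg (norm_nonneg _) two_ne_zero).1 this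

/-- On a connected set whose image under `z ↦ (z - b) ^ 2` is small compared to its distance from
the critical value, this map is uniformly expanding. -/
lemma two_mul_lt_norm_add_sq {E : Set ℂ} (hE : IsPreconnected E) {b : ℂ} {s ρ : ℝ} (hs : 0 < s)
    (hsE : ∀ z ∈ E, s ≤ ‖(z - b) ^ 2‖)
    (hρ : ∀ z ∈ E, ∀ w ∈ E, ‖(z - b) ^ 2 - (w - b) ^ 2‖ ≤ ρ) (hρs : ρ < 2 * s) {z w : ℂ}
    (hz : z ∈ E) (hw : w ∈ E) : 2 * s < ‖(z - b) + (w - b)‖ ^ 2 := by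
  have hcont : Continuous fun z : ℂ => ‖(z - b) + (w - b)‖ ^ 2 := by fun_prop
  refine hE.subset_of_closure_inter_subset (isOpen_lt continuous_const hcont) ?_ ?_ hz
  · refine ⟨w, hw, ?_⟩
    have := hsE w hw
    rw [norm_pow] at this
    rw [Set.mem_ofPred_eq, ← two_mul, norm_mul, mul_pow, Complex.norm_two]
    linarith
  · rintro x ⟨hx, hxE⟩
    have h1 : 2 * s ≤ ‖(x - b) + (w - b)‖ ^ 2 :=
      closure_minimal (fun y hy => le_of_lt hy) (isClosed_le continuous_const hcont) hx
    -- Equality cannot occur: by the parallelogram law the squared difference would also be at least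
    -- `2 * s`, and the product of sum and difference would exceed `ρ`. So the inequality, valid at
    -- `z = w`, persists on all of `E`.
    refine lt_of_le_of_ne h1 fun heq => ?_
    have h2 := parallelogram_law_with_norm ℝ (x - b) (w - b)
    have h3 := hsE x hxE
    have h4 := hsE w hw
    have h5 := hρ x hxE w hw
    rw [sq_sub_sq, norm_mul] at h5
    rw [norm_pow] at h3 h4
    have h6 : 2 * s ≤ ‖x - b - (w - b)‖ ^ 2 := by nlinarith
    have h7 : (2 * s) ^ 2 ≤ (‖x - b + (w - b)‖ * ‖x - b - (w - b)‖) ^ 2 := by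
      rw [sq (2 * s), mul_pow]
      exact mul_le_mul h1 h6 (by positivity) (by positivity)
    have h8 := abs_le_of_sq_le_sq' h7 (by positivity)
    linarith [h8.2]

/-- Connected sets of trapped points are small. -/
def SmallConnectedSets (m : ℕ) : Prop :=
  ∀ E : Set ℂ, IsPreconnected E → E ⊆ trapped m → ∀ z ∈ E, ∀ w ∈ E,
    ‖z - w‖ ≤ 2.64 ∧ (¬ IsShiftTime (m + 1) → ‖z - w‖ ≤ 1.5)

/-- The difference of the images is the sum times the difference. If a shift comes next, the images
have modulus at least `1.68` and `2.64 < 2 * 1.68`; otherwise their modulus exceeds `1` and `1.5 <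
2`. The sum then exceeds `√(2 * s)`, and both `2.64 / √3.36` and `1.5 / √2` are below `1.5`, so the
bound reproduces itself. -/
lemma SmallConnectedSets.of_succ {m : ℕ} (h : SmallConnectedSets (m + 1)) {E : Set ℂ}
    (hE : IsPreconnected E) (hEm : E ⊆ trapped m) {z w : ℂ} (hz : z ∈ E) (hw : w ∈ E) :
    2 < ‖(z - shiftCenter (m + 1)) + (w - shiftCenter (m + 1))‖ ^ 2 ∧ ‖z - w‖ ≤ 1.5 := by
  set b := shiftCenter (m + 1) with hb
  have himg : IsPreconnected ((fun z => (z - b) ^ 2) '' E) := hE.image _ (by fun_prop)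
  have hsub : (fun z => (z - b) ^ 2) '' E ⊆ trapped (m + 1) := by
    rintro _ ⟨x, hx, rfl⟩
    exact eval_mem_trapped (hEm hx)
  have hsmall : ∀ x ∈ E, ∀ y ∈ E, ‖(x - b) ^ 2 - (y - b) ^ 2‖ ≤ 2.64 ∧
      (¬ IsShiftTime (m + 1 + 1) → ‖(x - b) ^ 2 - (y - b) ^ 2‖ ≤ 1.5) := fun x hx y hy =>
    h _ himg hsub _ (Set.mem_image_of_mem _ hx) _ (Set.mem_image_of_mem _ hy)
  have hprod : ‖(z - b) + (w - b)‖ * ‖z - w‖ = ‖(z - b) ^ 2 - (w - b) ^ 2‖ := by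
    rw [sq_sub_sq, norm_mul, sub_sub_sub_cancel_right]
  by_cases hm : IsShiftTime (m + 1 + 1)
  · have h1 := two_mul_lt_norm_add_sq hE (s := 1.68) (ρ := 2.64) (by norm_num)
      (fun x hx => le_norm_of_isShiftTime hm (eval_mem_trapped (hEm hx)))
      (fun x hx y hy => (hsmall x hx y hy).1) (by norm_num) hz hw
    have h2 := (hsmall z hz w hw).1
    rw [← hprod] at h2
    norm_num at h1 h2 ⊢
    refine ⟨by linarith, ?_⟩
    by_contra! hlt
    nlinarith [norm_nonneg (z - b + (w - b))]
  · have h1 := two_mul_lt_norm_add_sq hE (s := 1) (ρ := 1.5) (by norm_num)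
      (fun x hx => (one_lt_norm_of_mem_trapped (eval_mem_trapped (hEm hx))).le)
      (fun x hx y hy => (hsmall x hx y hy).2 hm) (by norm_num) hz hw
    have h2 := (hsmall z hz w hw).2 hm
    rw [← hprod] at h2
    norm_num at h1 h2 ⊢
    refine ⟨by linarith, ?_⟩
    by_contra! hlt
    nlinarith [norm_nonneg (z - b + (w - b))]

lemma smallConnectedSets (m : ℕ) : SmallConnectedSets m := by
  induction m using shiftTime_induction with
  | base m hm =>
    intro E _ hEm z hz w hw
    refine ⟨?_, fun h => absurd hm h⟩
    have h1 := norm_sub_three_le hm (hEm hz)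
    have h2 := norm_sub_three_le hm (hEm hw)
    have h3 := norm_sub_le (z - 3) (w - 3)
    rw [sub_sub_sub_cancel_right] at h3
    norm_num at h1 h2 ⊢
    linarith
  | step m hm ih =>
    intro E hE hEm z hz w hw
    have := (ih.of_succ hE hEm hz hw).2
    refine ⟨?_, fun _ => this⟩
    norm_num at this ⊢
    linarith

/-- Each step multiplies distances within a connected trapped set by more than `√2 > 1.4`, and the
image is again connected and trapped. -/
lemma pow_mul_norm_sub_le (n : ℕ) {m : ℕ} {E : Set ℂ} (hE : IsPreconnected E)
    (hEm : E ⊆ trapped m) {z w : ℂ} (hz : z ∈ E) (hw : w ∈ E) :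
    1.4 ^ n * ‖z - w‖ ≤ 2.64 := by
  induction n generalizing m E z w with
  | zero => simpa using (smallConnectedSets m E hE hEm z hz w hw).1
  | succ n ih =>
    set b := shiftCenter (m + 1) with hb
    have himg : IsPreconnected ((fun z => (z - b) ^ 2) '' E) := hE.image _ (by fun_prop)
    have hsub : (fun z => (z - b) ^ 2) '' E ⊆ trapped (m + 1) := by
      rintro _ ⟨x, hx, rfl⟩
      exact eval_mem_trapped (hEm hx)
    have h1 := ih himg hsub (Set.mem_image_of_mem _ hz) (Set.mem_image_of_mem _ hw)
    have h2 := ((smallConnectedSets (m + 1)).of_succ hE hEm hz hw).1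
    refine le_trans ?_ h1
    rw [sq_sub_sq, norm_mul, sub_sub_sub_cancel_right, pow_succ, mul_assoc]
    gcongr
    norm_num
    nlinarith [norm_nonneg (z - b + (w - b))]

lemma isTotallyDisconnected_trapped (m : ℕ) : IsTotallyDisconnected (trapped m) := by
  intro E hEm hE z hz w hw
  by_contra hne
  have hpos : 0 < ‖z - w‖ := norm_pos_iff.2 (sub_ne_zero.2 hne)
  obtain ⟨n, hn⟩ := pow_unbounded_of_one_lt (2.64 / ‖z - w‖) (by norm_num : (1 : ℝ) < 1.4)
  rw [div_lt_iff₀ hpos] at hn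
  exact (pow_mul_norm_sub_le n hE hEm hz hw).not_gt hn

lemma isTotallyDisconnected_julia_shiftSeq (m : ℕ) :
    IsTotallyDisconnected (julia shiftSeq m) := by
  intro t ht htc
  have ht' : t ⊆ (↑) '' trapped m := ht.trans (julia_shiftSeq_subset m)
  have hpre : IsPreconnected ((↑) ⁻¹' t : Set ℂ) :=
    htc.preimage_of_isOpenMap OnePoint.coe_injective OnePoint.isOpenMap_coe
      (ht'.trans (Set.image_subset_range _ _))
  have hsub : ((↑) ⁻¹' t : Set ℂ) ⊆ trapped m := fun z hz =>
    (OnePoint.coe_injective.mem_set_image).1 (ht' hz)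
  rw [← Set.image_preimage_eq_of_subset (ht'.trans (Set.image_subset_range _ _))]
  exact (isTotallyDisconnected_trapped m _ hsub hpre).image _

/-! ### Polynomial-like restrictions of quadratic polynomials -/

namespace IsPolynomialLikeRestriction

variable {P : ℕ → ℂ[X]} {U V : ℕ → Set Sph} {u : ℕ → Sph} {a c v : ℕ → ℂ}

lemma isPointedDisc (h : IsPolynomialLikeRestriction P U V u) (m : ℕ) :
    IsPointedDisc (U m) (u m) :=
  (h.1.choose_spec.1 m).1

lemma base_mem (h : IsPolynomialLikeRestriction P U V u) (m : ℕ) : u m ∈ U m :=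
  (h.isPointedDisc m).1

lemma subset (h : IsPolynomialLikeRestriction P U V u) (m : ℕ) : U m ⊆ V m := by
  obtain ⟨d, -, K, -, ⟨-, -, hUV⟩, -⟩ := h.1
  exact (hUV m).1

lemma mem_iff (h : IsPolynomialLikeRestriction P U V u)
    (hP : ∀ m, IsQuadratic (P (m + 1)) (a m) (c m) (v m)) {m : ℕ} {z : Sph} :
    z ∈ U m ↔ polyMap (P (m + 1)) z ∈ V (m + 1) := by
  have hprop := h.2 m
  refine ⟨fun hz => hprop.image_eq ▸ ⟨z, hz, rfl⟩, fun hz => ?_⟩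
  rw [(hP m).natDegree_eq] at hprop
  exact (hP m).mem_of_polyMap_mem (h.isPointedDisc m).isOpen (h.isPointedDisc m).isPreconnected
    (h.1.choose_spec.1 (m + 1)).2.isOpen hprop hz

lemma base_eq (h : IsPolynomialLikeRestriction P U V u)
    (hP : ∀ m, IsQuadratic (P (m + 1)) (a m) (c m) (v m)) (m : ℕ) :
    u m = (c m : Sph) ∨ u m = OnePoint.infty := by
  obtain ⟨d, -, K, -, -, hcrit, -⟩ := h.1
  exact (hP m).eq_of_isCriticalPt (hcrit m).2

/-- The domain of a quadratic-like restriction contains only one of the two critical points. -/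
lemma infty_notMem (h : IsPolynomialLikeRestriction P U V u)
    (hP : ∀ m, IsQuadratic (P (m + 1)) (a m) (c m) (v m)) {m : ℕ} (hc : (c m : Sph) ∈ U m) :
    OnePoint.infty ∉ U m := by
  refine (h.isPointedDisc m).infty_notMem_of_reflect (fun z hz => ?_) hc
  rw [h.mem_iff hP] at hz ⊢
  rwa [(hP m).polyMap_reflect]

/-- If `∞` were the next base point, its preimage `∞` would lie in `U n` beside the finite critical
point. -/
lemma base_ne_infty_of_le (h : IsPolynomialLikeRestriction P U V u)
    (hP : ∀ m, IsQuadratic (P (m + 1)) (a m) (c m) (v m)) {m n : ℕ} (hmn : m ≤ n)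
    (hm : u m ≠ OnePoint.infty) : u n ≠ OnePoint.infty := by
  induction n, hmn using Nat.le_induction with
  | base => exact hm
  | succ n _ ih =>
    intro hn
    have hc : (c n : Sph) ∈ U n := (h.base_eq hP n).resolve_right ih ▸ h.base_mem n
    refine h.infty_notMem hP hc ((h.mem_iff hP).2 ?_)
    rw [polyMap_infty, ← hn]
    exact h.subset _ (h.base_mem _)

lemma base_eq_of_le (h : IsPolynomialLikeRestriction P U V u)
    (hP : ∀ m, IsQuadratic (P (m + 1)) (a m) (c m) (v m)) {m n : ℕ} (hmn : m ≤ n)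
    (hm : u m ≠ OnePoint.infty) : u n = (c n : Sph) :=
  (h.base_eq hP n).resolve_right (h.base_ne_infty_of_le hP hmn hm)

lemma mem_of_compFrom_mem (h : IsPolynomialLikeRestriction P U V u)
    (hP : ∀ m, IsQuadratic (P (m + 1)) (a m) (c m) (v m)) {m k : ℕ} {z : Sph}
    (hz : compFrom (fun i => polyMap (P i)) m k z ∈ U (m + k)) : z ∈ U m := by
  induction k with
  | zero => exact hz
  | succ k ih => exact ih ((h.mem_iff hP).2 (h.subset _ hz))

end IsPolynomialLikeRestriction

/-- A domain of bounded Carathéodory bound which contains infinity and omits two points contains a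
definite neighbourhood of infinity. -/
lemma le_boundaryDist_infty {U : Set Sph} (hU : IsOpen U) (hinf : OnePoint.infty ∈ U) {z w : Sph}
    (hz : z ∉ U) (hw : w ∉ U) (hzw : z ≠ w) {K : ℝ}
    (hK : |Real.log (boundaryDist U OnePoint.infty * sphDiam Uᶜ)| ≤ K) :
    Real.exp (-K) / (Real.pi / 2) ≤ boundaryDist U OnePoint.infty := by
  -- Since `Real.log 0 = 0`, the bound carries information only when both factors are positive; the
  -- two omitted points make the diameter positive.
  have hdiam : 0 < sphDiam Uᶜ := (sphDist_pos hzw).trans_le (sphDist_le_sphDiam hz hw)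
  have hcompact : IsCompact ((↑) ⁻¹' U : Set ℂ)ᶜ := ((OnePoint.isOpen_iff_of_mem hinf).1 hU).2
  have hne : (((↑) ⁻¹' U : Set ℂ)ᶜ).Nonempty := by
    obtain ⟨z', rfl⟩ := OnePoint.ne_infty_iff_exists.1 fun h : z = OnePoint.infty => hz (h ▸ hinf)
    exact ⟨z', hz⟩
  obtain ⟨x, -, hxmin⟩ := hcompact.exists_isMinOn hne
    (continuous_sphDist_coe OnePoint.infty).continuousOn
  have hfr : (frontier U).Nonempty :=
    nonempty_frontier_iff.2 ⟨⟨_, hinf⟩, fun h => hz (h ▸ Set.mem_univ z)⟩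
  have hbd : 0 < boundaryDist U OnePoint.infty := by
    refine (sphDist_pos (OnePoint.coe_ne_infty x)).trans_le (le_csInf (hfr.image _) ?_)
    rintro _ ⟨y, hy, rfl⟩
    have hyU : y ∉ U := fun h => hy.2 (by rwa [hU.interior_eq])
    obtain ⟨y', rfl⟩ := OnePoint.ne_infty_iff_exists.1 fun h : y = OnePoint.infty => hyU (h ▸ hinf)
    exact hxmin hyU
  have hprod : Real.exp (-K) ≤ boundaryDist U OnePoint.infty * sphDiam Uᶜ :=
    (Real.le_log_iff_exp_le (mul_pos hbd hdiam)).1 (abs_le.1 hK).1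
  rw [div_le_iff₀ (by positivity)]
  exact hprod.trans (mul_le_mul_of_nonneg_left (sphDiam_le _) hbd.le)

section ShiftSeq

variable {U V : ℕ → Set Sph} {u : ℕ → Sph}

/-- The base points of a polynomial-like restriction of `shiftSeq` are not all at infinity. -/
lemma exists_base_ne_infty (h : IsPolynomialLikeRestriction shiftSeq U V u) :
    ∃ m, u m ≠ OnePoint.infty := by
  by_contra! hu
  have hP := fun m => isQuadratic_shiftSeq (m + 1)
  have hinf : ∀ m, OnePoint.infty ∈ U m := fun m => hu m ▸ h.base_mem m
  have hcrit : ∀ m, (shiftCenter (m + 1) : Sph) ∉ U m := fun m hc => h.infty_notMem hP hc (hinf m)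
  obtain ⟨d, -, K, -, ⟨hK, -, -⟩, -⟩ := h.1
  obtain ⟨R, hR⟩ := exists_forall_mem_of_le_boundaryDist
    (show 0 < Real.exp (-K) / (Real.pi / 2) by positivity)
  have h1 : ¬ IsShiftTime 1 := by
    rintro ⟨j, hj, hj'⟩
    rw [add_one_eq_half_iff] at hj'
    have : 2 * 3 ≤ (j + 1) * (j + 2) := Nat.mul_le_mul (by omega) (by omega)
    omega
  obtain ⟨k, hk⟩ := exists_nine_le_norm_shiftIter_zero 0
  obtain ⟨N, hN⟩ := eventually_atTop.1 ((tendsto_norm_shiftIter hk).eventually_gt_atTop R)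
  -- Just before a shift, `U (m + 1)` omits two definite points: the critical point `3`, and `0`,
  -- because `0` is the critical point one step earlier and is fixed by that step.
  obtain ⟨n, hn, hshift⟩ := exists_isShiftTime_ge (N + 2)
  obtain ⟨m, rfl⟩ := Nat.exists_eq_add_of_le' (show 2 ≤ n by omega)
  have hm : ¬ IsShiftTime (m + 1) := fun hm => hm.not_add_one hshift
  have h3 : ((3 : ℂ) : Sph) ∉ U (m + 1) := by
    have := hcrit (m + 1)
    rwa [shiftCenter_of_isShiftTime hshift] at this
  have h0 : ((0 : ℂ) : Sph) ∉ U (m + 1) := by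
    intro h0
    have := hcrit m
    rw [shiftCenter_of_not hm, h.mem_iff hP, polyMap_coe, eval_shiftSeq,
      shiftCenter_of_not hm, sub_zero, zero_pow two_ne_zero] at this
    exact this (h.subset _ h0)
  have hKm := hK (m + 1)
  rw [hu] at hKm
  have hbd := le_boundaryDist_infty (h.isPointedDisc _).isOpen (hinf _) h3 h0
    (fun h => three_ne_zero (OnePoint.coe_eq_coe.1 h)) hKm
  have hmem := hR _ (h.isPointedDisc _).isOpen (hinf _) hbd _ (hN (m + 1) (by omega))
  have hzero : ((0 : ℂ) : Sph) ∈ U 0 := by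
    refine h.mem_of_compFrom_mem hP (k := m + 1) ?_
    rwa [compFrom_polyMap_coe, zero_add]
  have := hcrit 0
  rw [shiftCenter_of_not h1] at this
  exact this hzero

variable {U' V' : ℕ → Set Sph} {u' : ℕ → Sph} {Φ : ℕ → Sph → Sph} {Q : ℂ[X]} {a c v : ℂ}

/-- The base points of a restriction of a constant sequence conjugate to one of `shiftSeq` are not
all at infinity. -/
lemma IsQCConjugacy.exists_base_ne_infty
    (h : IsPolynomialLikeRestriction shiftSeq U V u)
    (hΦ : IsQCConjugacy U u (fun m => polyMap (shiftSeq m)) U' u' (fun _ => polyMap Q) Φ) :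
    ∃ m, u' m ≠ OnePoint.infty := by
  by_contra! hu'
  have hP := fun m => isQuadratic_shiftSeq (m + 1)
  -- `∞` is its own only preimage under `Q`, so the conjugacy forces the preimage of `u (m + 1)` in
  -- `U m` to be `u m`.
  have hfix : ∀ m, polyMap (shiftSeq (m + 1)) (u m) = u (m + 1) := by
    intro m
    obtain ⟨z, hz, hzu⟩ : u (m + 1) ∈ polyMap (shiftSeq (m + 1)) '' U m := by
      rw [(h.2 m).image_eq]
      exact h.subset _ (h.base_mem _)
    have hconj := hΦ.conj m z hz (hzu ▸ h.base_mem (m + 1))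
    rw [hzu, hΦ.base, hu', eq_comm, polyMap_eq_infty] at hconj
    have : z = u m :=
      (hΦ.bijOn m).injOn hz (h.base_mem m) (by rw [hconj, hΦ.base, hu'])
    rw [← this, hzu]
  obtain ⟨m₀, hm₀⟩ := NonautDyn.exists_base_ne_infty h
  obtain ⟨n, hn, hshift⟩ := exists_isShiftTime_ge (m₀ + 2)
  obtain ⟨m, rfl⟩ := Nat.exists_eq_add_of_le' (show 2 ≤ n by omega)
  have hm : ¬ IsShiftTime (m + 1) := fun hm => hm.not_add_one hshift
  have h0 := h.base_eq_of_le hP (show m₀ ≤ m by omega) hm₀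
  have h3 := h.base_eq_of_le hP (show m₀ ≤ m + 1 by omega) hm₀
  have := hfix m
  rw [h0, h3, shiftCenter_of_not hm, shiftCenter_of_isShiftTime hshift, polyMap_coe,
    eval_shiftSeq, shiftCenter_of_not hm, OnePoint.coe_eq_coe] at this
  norm_num at this

/-- A quadratic polynomial conjugate to `shiftSeq` has a fixed critical point, since the critical
point of `shiftSeq` is fixed over runs of `z ^ 2`. -/
lemma IsQCConjugacy.critical_value_eq (hQ : IsQuadratic Q a c v)
    (h : IsPolynomialLikeRestriction shiftSeq U V u)
    (h' : IsPolynomialLikeRestriction (fun _ => Q) U' V' u')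
    (hΦ : IsQCConjugacy U u (fun m => polyMap (shiftSeq m)) U' u' (fun _ => polyMap Q) Φ) :
    v = c := by
  obtain ⟨m₀, hm₀⟩ := NonautDyn.exists_base_ne_infty h
  obtain ⟨m₁, hm₁⟩ := hΦ.exists_base_ne_infty h
  obtain ⟨m, hm, hs1, hs2⟩ := exists_not_isShiftTime_run (m₀ + m₁)
  have hP := fun m => isQuadratic_shiftSeq (m + 1)
  have hu := fun n (hn : m ≤ n) => h.base_eq_of_le hP (show m₀ ≤ n by omega) hm₀
  have hu' := fun n (hn : m ≤ n) =>
    h'.base_eq_of_le (fun _ => hQ) (show m₁ ≤ n by omega) hm₁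
  have h0 : u m = ((0 : ℂ) : Sph) := by rw [hu m le_rfl, shiftCenter_of_not hs1]
  have h1 : u (m + 1) = ((0 : ℂ) : Sph) := by rw [hu (m + 1) (by omega), shiftCenter_of_not hs2]
  have hfix : polyMap (shiftSeq (m + 1)) (u m) = u (m + 1) := by
    rw [h0, h1, polyMap_coe, eval_shiftSeq, shiftCenter_of_not hs1, sub_zero,
      zero_pow two_ne_zero]
  have hconj := hΦ.conj m (u m) (h.base_mem m) (hfix ▸ h.base_mem (m + 1))
  rw [hfix, hΦ.base, hΦ.base, hu' m le_rfl, hu' (m + 1) (by omega), polyMap_coe,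
    OnePoint.coe_eq_coe, hQ.eval_eq, sub_self, zero_pow two_ne_zero, mul_zero, zero_add] at hconj
  exact hconj.symm

end ShiftSeq

end NonautDyn

/-- There is a bounded sequence of quadratic polynomials, namely `z ^ 2` with `(z - 3) ^ 2` at the
times `(j + 1) (j + 2) / 2 - 1`, `j ≥ 1`, all of whose critical points escape and all of whose
iterated Julia sets are totally disconnected, which is not hybrid equivalent to any
quadratic polynomial with disconnected Julia set (a constant sequence); in fact no
quasiconformal conjugacy between the two is bi-equicontinuous. -/
theorem theorem7p2 :
    ∃ P : ℕ → ℂ[X],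
      (∀ m : ℕ, 1 ≤ m → (∃ j : ℕ, 1 ≤ j ∧ m + 1 = (j + 1) * (j + 2) / 2) →
        P m = (X - C 3) ^ 2) ∧
      (∀ m : ℕ, 1 ≤ m → (¬ ∃ j : ℕ, 1 ≤ j ∧ m + 1 = (j + 1) * (j + 2) / 2) →
        P m = X ^ 2) ∧
      IsBoundedSeq P ∧
      (∀ m : ℕ, 1 ≤ m → (P m).natDegree = 2) ∧
      AllCriticalPointsEscape P ∧
      (∀ m : ℕ, IsTotallyDisconnected (julia P m)) ∧
      ∀ Q : ℂ[X], Q.natDegree = 2 → ¬ IsPreconnected (julia (fun _ => Q) 0) →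
        ¬ HybridEquivalent P (fun _ => Q) ∧
        ∀ (U V : ℕ → Set Sph) (u : ℕ → Sph) (U' V' : ℕ → Set Sph) (u' : ℕ → Sph)
          (Φ : ℕ → Sph → Sph),
          IsPolynomialLikeRestriction P U V u →
          IsPolynomialLikeRestriction (fun _ => Q) U' V' u' →
          IsQCConjugacy U u (fun m => polyMap (P m)) U' u' (fun _ => polyMap Q) Φ →
          ¬ IsBiEquicontinuous Φ U u := by
  have key : ∀ Q : ℂ[X], Q.natDegree = 2 → ¬ IsPreconnected (julia (fun _ => Q) 0) →
      ∀ (U V : ℕ → Set Sph) (u : ℕ → Sph) (U' V' : ℕ → Set Sph) (u' : ℕ → Sph)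
        (Φ : ℕ → Sph → Sph),
        IsPolynomialLikeRestriction shiftSeq U V u →
        IsPolynomialLikeRestriction (fun _ => Q) U' V' u' →
        ¬ IsQCConjugacy U u (fun m => polyMap (shiftSeq m)) U' u' (fun _ => polyMap Q) Φ := by
    intro Q hdeg hJ U V u U' V' u' Φ h h' hΦ
    obtain ⟨a, c, v, hQ⟩ := exists_isQuadratic hdeg
    obtain rfl := hΦ.critical_value_eq hQ h h'
    exact hJ hQ.isPreconnected_julia
  refine ⟨shiftSeq, fun m _ h => shiftSeq_of_isShiftTime h, fun m _ h => shiftSeq_of_not h,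
    isBoundedSeq_shiftSeq, fun m _ => natDegree_shiftSeq m, allCriticalPointsEscape_shiftSeq,
    isTotallyDisconnected_julia_shiftSeq, fun Q hdeg hJ => ⟨?_, ?_⟩⟩
  · rintro ⟨U, V, u, U', V', u', h, h', Φ, hΦ⟩
    exact key Q hdeg hJ U V u U' V' u' Φ h h' hΦ.conjugacy
  · intro U V u U' V' u' Φ h h' hΦ _
    exact key Q hdeg hJ U V u U' V' u' Φ h h' hΦ
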